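/- Let $\mathrm{Sym}=\mathbb{Q}[p_1,p_2,p_3,\dots]$ be the ring of symmetric functions. For a partition $\gamma$, let $m_i(\gamma)$ be the number of parts equal to $i$, $z_\gamma=\prod_{i\ge1} m_i(\gamma)!\,i^{m_i(\gamma)}$, $p_\gamma=\prod_j p_{\gamma_j}$, and let $\langle\cdot,\cdot\rangle$ be the Hall inner product, $\langle p_\gamma,p_\mu\rangle=z_\gamma\delta_{\gamma\mu}$. Let $h_\mu=\prod_j h_{\mu_j}$ with $h_n=\sum_{\gamma\vdash n}p_\gamma/z_\gamma$, let $s_\lambda=\det[h_{\lambda_i-i+j}]_{1\le i,j\le\ell(\lambda)}$ be the Schur functions, let $\chi^\lambda(\gamma)=\langle s_\lambda,p_\gamma\rangle$ be the irreducible characters of the symmetric groups, and let $K_{\lambda\mu}=\langle s_\lambda,h_\mu\rangle$ be the Kostka coefficients, so that $h_\mu=\sum_\lambda K_{\lambda\mu}s_\lambda$. The induced trivial character basis $\{\tilde h_\lambda\}$ of $\mathrm{Sym}$ is defined recursively by $$h_\lambda=\sum_{\pi}\tilde h_{\tilde m(\pi)},$$ where $\pi$ runs over the multiset partitions of the multiset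 $\{1^{\lambda_1},2^{\lambda_2},\dots,\ell^{\lambda_\ell}\}$ (the multisets of nonempty multisets whose union with multiplicities is that multiset), and $\tilde m(\pi)$ is the partition formed by the multiplicities of the distinct blocks of $\pi$. The irreducible character basis $\{\tilde s_\lambda\}$ is defined by $$\tilde s_\lambda=\sum_{|\mu|\le|\lambda|}K^{-1}_{(N-|\lambda|,\lambda)(N-|\mu|,\mu)}\,\tilde h_\mu,$$ where $N\ge 2|\lambda|$ is any integer and $K^{-1}_{\alpha\beta}$ denotes the coefficient of $h_\beta$ in the expansion of $s_\alpha$ in the basis $\{h_\beta\}$. Theorem. For every $n\ge0$, every partition $\lambda\vdash n$ and every choice of $N\ge 2n$ in the definition of $\tilde s_\lambda$, $$\tilde s_\lambda=\sum_{\gamma\vdash n}\chi^\lambda(\gamma)\,\frac{\mathbf p_\gamma}{z_\gamma},$$ where $$\mathbf p_{i^r}=\sum_{k=0}^r(-1)^{r-k}\,i^k\binom rk\Bigl(\frac1i\sum_{d\mid i}\mu(i/d)\,p_d\Bigr)_k,\qquad \mathbf p_\gamma=\prod_{i\ge1}\mathbf p_{i^{m_i(\gamma)}},$$ $\mu$ in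 the first formula is the Möbius function, and $(x)_k=x(x-1)\cdots(x-k+1)$ is the falling factorial. -/

import Mathlib

namespace CharBasis

open scoped Nat

/-! ### The ring of symmetric functions `ℚ[p₁, p₂, p₃, …]` -/

/-- The ring of symmetric functions, as the polynomial ring over `ℚ` in the power sums
`p₁, p₂, p₃, …`; the variable `X k` is the power sum `p_k`. -/
abbrev SymFun : Type := MvPolynomial ℕ+ ℚ

/-- The power sum `p_k`, for `k ≥ 1`. -/
noncomputable def p (k : ℕ) : SymFun := MvPolynomial.X k.toPNat'

/-- `p_γ`, the product of the `p_{γ_i}`. -/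
noncomputable def pPart {n : ℕ} (γ : n.Partition) : SymFun := (γ.parts.map p).prod

/-- `z_γ = ∏_{i ≥ 1} m_i(γ)! i^{m_i(γ)}`. -/
def z {n : ℕ} (γ : n.Partition) : ℚ :=
  ∏ i ∈ Finset.Icc 1 n, ((γ.parts.count i)! : ℚ) * (i : ℚ) ^ (γ.parts.count i)

/-- The complete homogeneous symmetric function `h_n = ∑_{γ ⊢ n} p_γ / z_γ`. -/
noncomputable def h (n : ℕ) : SymFun := ∑ γ : n.Partition, (z γ)⁻¹ • pPart γ

/-- `h_μ`, the product of the `h_{μ_i}`. -/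
noncomputable def hPart {n : ℕ} (μ : n.Partition) : SymFun := (μ.parts.map h).prod

/-- `h_k` for an integer `k`, which is `0` for negative `k`. -/
noncomputable def hInt (k : ℤ) : SymFun := if 0 ≤ k then h k.toNat else 0

/-- The `i`-th part (counted from `i = 0`) of a partition in weakly decreasing order,
and `0` past the end. -/
def row {n : ℕ} (lam : n.Partition) (i : ℕ) : ℕ := (lam.parts.sort (· ≥ ·)).getD i 0

/-- The Schur function `s_λ = det [h_{λ_i - i + j}]`, of size the length of `λ`. -/
noncomputable def schur {n : ℕ} (lam : n.Partition) : SymFun :=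
  Matrix.det (Matrix.of fun i j : Fin lam.parts.card =>
    hInt ((row lam i : ℤ) - (i : ℤ) + (j : ℤ)))

/-- The Hall inner product: the bilinear form on `ℚ[p₁, p₂, …]` for which the monomials
`p₁^{a₁} p₂^{a₂} ⋯` are orthogonal, with square norm `∏_i a_i! i^{a_i}`,
that is, `⟨p_γ, p_μ⟩ = z_γ δ_{γμ}`. -/
noncomputable def hall (f g : SymFun) : ℚ :=
  ∑ a ∈ f.support, f.coeff a * g.coeff a * a.prod fun i e => (e ! : ℚ) * (i : ℚ) ^ e

/-- The irreducible character value `χ^λ(γ) = ⟨s_λ, p_γ⟩` of the symmetric group. -/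
noncomputable def chi {n : ℕ} (lam γ : n.Partition) : ℚ := hall (schur lam) (pPart γ)

/-- The matrix of Kostka coefficients `K_{λμ} = ⟨s_λ, h_μ⟩`, `λ, μ ⊢ n`
(the coefficient of `s_λ` in `h_μ`). -/
noncomputable def kostka (n : ℕ) : Matrix n.Partition n.Partition ℚ :=
  Matrix.of fun lam μ => hall (schur lam) (hPart μ)

/-! ### Multiset partitions -/

/-- The multiset partitions of a multiset `M`: the multisets of nonempty multisets whose sum
is `M` (see `mem_multisetPartitions`). -/
def multisetPartitions (M : Multiset ℕ) : Finset (Multiset (Multiset ℕ)) :=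
  (M.card • M.powerset).powerset.toFinset.filter fun π => π.sum = M ∧ 0 ∉ π

theorem card_le_of_sum {M : Multiset ℕ} {π : Multiset (Multiset ℕ)} (h1 : π.sum = M)
    (h2 : 0 ∉ π) : π.card ≤ M.card := by
  induction π using Multiset.induction generalizing M with
  | empty => simp
  | cons S π ih =>
    subst h1
    have := ih rfl (fun hh => h2 (Multiset.mem_cons_of_mem hh))
    have hS : 0 < S.card := Multiset.card_pos.2 (fun hh => h2 (by simp [hh]))
    simp only [Multiset.card_cons, Multiset.sum_cons, Multiset.card_add]
    omega

theorem mem_multisetPartitions {M : Multiset ℕ} {π : Multiset (Multiset ℕ)} :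
    π ∈ multisetPartitions M ↔ π.sum = M ∧ 0 ∉ π := by
  simp only [multisetPartitions, Finset.mem_filter, Multiset.mem_toFinset,
    Multiset.mem_powerset, and_iff_right_iff_imp]
  rintro ⟨h1, h2⟩
  rw [Multiset.le_iff_count]
  intro S
  by_cases hS : S ∈ π
  · have hle : S ≤ M := h1 ▸ Multiset.single_le_sum (fun _ _ => Multiset.zero_le _) S hS
    rw [Multiset.count_nsmul]
    calc π.count S ≤ π.card := Multiset.count_le_card _ _
      _ ≤ M.card * 1 := by simpa using card_le_of_sum h1 h2
      _ ≤ M.card * M.powerset.count S :=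
        Nat.mul_le_mul_left _ (Multiset.one_le_count_iff_mem.2 (Multiset.mem_powerset.2 hle))
  · simp [Multiset.count_eq_zero_of_notMem hS]

/-- `m̃(π)`: the partition of `ℓ(π)` formed by the multiplicities with which the distinct
blocks of `π` occur in `π`. -/
def multType (π : Multiset (Multiset ℕ)) : Nat.Partition π.card where
  parts := π.dedup.map fun S => π.count S
  parts_pos := by
    intro i hi
    obtain ⟨S, hS, rfl⟩ := Multiset.mem_map.1 hi
    exact Multiset.count_pos.2 (Multiset.mem_dedup.1 hS)
  parts_sum := Multiset.toFinset_sum_count_eq π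

/-- The multiset `{{1^{λ₁}, 2^{λ₂}, …, ℓ^{λ_ℓ}}}`. -/
def content {n : ℕ} (lam : n.Partition) : Multiset ℕ :=
  ∑ i ∈ Finset.range lam.parts.card, Multiset.replicate (row lam i) (i + 1)

theorem map_row {n : ℕ} (lam : n.Partition) :
    (Multiset.range lam.parts.card).map (row lam) = lam.parts := by
  conv_rhs => rw [← Multiset.sort_eq lam.parts (· ≥ ·)]
  rw [← Multiset.coe_range, Multiset.map_coe, Multiset.coe_eq_coe]
  apply List.Perm.of_eq
  apply List.ext_getElem
  · simp
  · intro i h1 h2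
    rw [List.getElem_map, List.getElem_range, row]
    exact List.getD_eq_getElem _ _ h2

theorem card_content {n : ℕ} (lam : n.Partition) : (content lam).card = n := by
  rw [content, Multiset.card_sum]
  simp only [Multiset.card_replicate]
  rw [Finset.sum, Finset.range_val, map_row, lam.parts_sum]

theorem row_pos {n : ℕ} (lam : n.Partition) {i : ℕ} (hi : i < lam.parts.card) :
    0 < row lam i := by
  have hmem := Multiset.mem_map_of_mem (row lam) (Multiset.mem_range.2 hi)
  rw [map_row] at hmem
  exact lam.parts_pos hmem

theorem count_content {n : ℕ} (lam : n.Partition) {i : ℕ} (hi : i < lam.parts.card) :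
    (content lam).count (i + 1) = row lam i := by
  rw [content, Multiset.count_sum']
  simp only [Multiset.count_replicate, Nat.add_right_cancel_iff]
  rw [Finset.sum_ite_eq' (Finset.range lam.parts.card) i]
  simp [hi]

theorem dedup_content {n : ℕ} (lam : n.Partition) :
    (content lam).dedup = (Multiset.range lam.parts.card).map (· + 1) := by
  refine Multiset.Nodup.ext (Multiset.nodup_dedup _) ?_ |>.2 fun a => ?_
  · exact (Multiset.nodup_range _).map (fun _ _ hab => Nat.succ.inj hab)
  · rw [Multiset.mem_dedup, content, Multiset.mem_sum]
    simp only [Finset.mem_range, Multiset.mem_map, Multiset.mem_range]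
    constructor
    · rintro ⟨i, hi, hh⟩
      exact ⟨i, hi, (Multiset.eq_of_mem_replicate hh).symm⟩
    · rintro ⟨i, hi, rfl⟩
      exact ⟨i, hi, Multiset.mem_replicate.2 ⟨(row_pos lam hi).ne', rfl⟩⟩

theorem eq_singletons {M : Multiset ℕ} {π : Multiset (Multiset ℕ)} (h1 : π.sum = M)
    (h2 : 0 ∉ π) (h3 : M.card ≤ π.card) : π = M.map fun a => {a} := by
  induction π using Multiset.induction generalizing M with
  | empty => simp [← h1]
  | cons S π ih =>
    subst h1
    have h2' : 0 ∉ π := fun hh => h2 (Multiset.mem_cons_of_mem hh)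
    have hle := card_le_of_sum rfl h2'
    have hS : 0 < S.card := Multiset.card_pos.2 (fun hh => h2 (by simp [hh]))
    simp only [Multiset.card_cons, Multiset.sum_cons, Multiset.card_add] at h3
    obtain ⟨a, rfl⟩ := Multiset.card_eq_one.1 (show S.card = 1 by omega)
    rw [Multiset.sum_cons, Multiset.map_add, ← ih rfl h2' (by omega)]
    simp

theorem multType_singletons {n : ℕ} (lam : n.Partition) :
    (multType ((content lam).map fun a => {a})).parts = lam.parts := by
  have hinj : Function.Injective (fun a : ℕ => ({a} : Multiset ℕ)) :=
    fun a b hab => Multiset.singleton_inj.1 hab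
  simp only [multType]
  rw [Multiset.dedup_map_of_injective hinj, Multiset.map_map, dedup_content, Multiset.map_map]
  conv_rhs => rw [← map_row lam]
  refine Multiset.map_congr rfl fun i hi => ?_
  simp only [Function.comp]
  rw [Multiset.count_map_eq_count' _ _ hinj, count_content lam (Multiset.mem_range.1 hi)]

theorem card_lt_of_multType_ne {n : ℕ} {lam : n.Partition} {π : Multiset (Multiset ℕ)}
    (hπ : π ∈ multisetPartitions (content lam)) (hne : (multType π).parts ≠ lam.parts) :
    π.card < n := by
  obtain ⟨h1, h2⟩ := mem_multisetPartitions.1 hπ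
  by_contra hlt
  have := eq_singletons h1 h2 (by rw [card_content]; omega)
  subst this
  exact hne (multType_singletons lam)

/-! ### The two character bases -/

/-- The induced trivial character basis `h̃_λ`, defined recursively by
`h̃_λ = h_λ - ∑_π h̃_{m̃(π)}`, the sum being over the multiset partitions `π` of
`{{1^{λ₁}, …, ℓ^{λ_ℓ}}}` with `m̃(π) ≠ λ`. -/
noncomputable def hTilde {n : ℕ} (lam : n.Partition) : SymFun :=
  hPart lam - ∑ π ∈ ((multisetPartitions (content lam)).filter
    fun π => (multType π).parts ≠ lam.parts).attach, hTilde (multType π.1)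
termination_by n
decreasing_by
  exact card_lt_of_multType_ne (Finset.mem_filter.1 π.2).1 (Finset.mem_filter.1 π.2).2

/-- The defining relation `h_λ = ∑_π h̃_{m̃(π)}` of the induced trivial character basis. -/
theorem hPart_eq_sum_hTilde {n : ℕ} (lam : n.Partition) :
    hPart lam = ∑ π ∈ multisetPartitions (content lam), hTilde (multType π) := by
  have hcongr : ∀ {a b : ℕ} (hab : a = b) (α : a.Partition) (β : b.Partition),
      α.parts = β.parts → hTilde α = hTilde β := by
    rintro a _ rfl α β hp
    rw [Nat.Partition.ext hp]
  have hfilter : (multisetPartitions (content lam)).filter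
      (fun π => ¬ (multType π).parts ≠ lam.parts) = {(content lam).map fun a => {a}} := by
    ext π
    simp only [Finset.mem_filter, not_not, Finset.mem_singleton, mem_multisetPartitions]
    constructor
    · rintro ⟨⟨h1, h2⟩, h3⟩
      refine eq_singletons h1 h2 ?_
      have := congrArg Multiset.sum h3
      rw [(multType π).parts_sum, lam.parts_sum] at this
      rw [card_content, this]
    · rintro rfl
      refine ⟨⟨Multiset.sum_map_singleton _, ?_⟩, multType_singletons lam⟩
      intro hh
      obtain ⟨a, -, ha⟩ := Multiset.mem_map.1 hh
      exact Multiset.singleton_ne_zero a ha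
  rw [← Finset.sum_filter_add_sum_filter_not _ (fun π => (multType π).parts ≠ lam.parts),
    hfilter, Finset.sum_singleton,
    hcongr (by rw [Multiset.card_map, card_content]) _ lam (multType_singletons lam)]
  conv_rhs => enter [2]; rw [hTilde]
  rw [Finset.sum_attach _ (fun π => hTilde (multType π))]
  abel

/-- `(N - |μ|, μ)`, as a partition of `N` (a part `N - |μ| = 0` is dropped). -/
def addRow {m : ℕ} (N : ℕ) (μ : m.Partition) (hm : m ≤ N) : N.Partition :=
  Nat.Partition.ofSums N ((N - m) ::ₘ μ.parts) (by
    rw [Multiset.sum_cons, μ.parts_sum]; omega)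

/-- The irreducible character basis
`s̃_λ = ∑_{|μ| ≤ |λ|} K⁻¹_{(N-|λ|,λ),(N-|μ|,μ)} h̃_μ`, where `N ≥ 2|λ|`. Here `K⁻¹` is the
coefficient of `h_{(N-|μ|,μ)}` in `s_{(N-|λ|,λ)}`; since `h_μ = ∑_λ K_{λμ} s_λ`, this is the
entry in row `(N-|μ|,μ)` and column `(N-|λ|,λ)` of the inverse of the matrix `(K_{λμ})`. -/
noncomputable def sTilde {n : ℕ} (N : ℕ) (lam : n.Partition) (hN : 2 * n ≤ N) : SymFun :=
  ∑ m : Fin (n + 1), ∑ μ : Nat.Partition m,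
    (kostka N)⁻¹ (addRow N μ (by omega)) (addRow N lam (by omega)) • hTilde μ

/-! ### The power sum expansion -/

/-- `(1/i) ∑_{d ∣ i} μ(i/d) p_d`. -/
noncomputable def cyc (i : ℕ) : SymFun :=
  (1 / i : ℚ) • ∑ d ∈ i.divisors, (ArithmeticFunction.moebius (i / d) : ℚ) • p d

/-- `𝐩_{i^r} = ∑_{k=0}^r (-1)^{r-k} i^k (r choose k) ((1/i) ∑_{d ∣ i} μ(i/d) p_d)_k`,
with `(x)_k = x (x - 1) ⋯ (x - k + 1)`. -/
noncomputable def boldP (i r : ℕ) : SymFun :=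
  ∑ k ∈ Finset.range (r + 1), ((-1) ^ (r - k) * (i : ℚ) ^ k * (r.choose k : ℚ)) •
    (descPochhammer SymFun k).eval (cyc i)

/-- `𝐩_γ = ∏_{i ≥ 1} 𝐩_{i^{m_i(γ)}}` (the factors with `i > |γ|` are `𝐩_{i^0} = 1`). -/
noncomputable def boldPPart {n : ℕ} (γ : n.Partition) : SymFun :=
  ∏ i ∈ Finset.Icc 1 n, boldP i (γ.parts.count i)

end CharBasis

namespace CharBasis

open MvPolynomial

/-! ### Exponents of monomials and partitions -/

/-! Evaluate a symmetric function at the eigenvalues of a permutation with cycle type x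
(`evalCycle`): p_k becomes the sum of the cycle lengths dividing k, and by Möbius inversion `cyc i`
becomes the number X_i of i-cycles. These values determine the function (`ext_evalCycle`). Let Ψ =
`fallMap` be the linear map sending ∏ p_i^{a_i} to ∏ i^{a_i} (X_i)_{a_i}. The heart of the proof is
h̃_λ = Ψ(h_λ) (`hTilde_eq_fallMap`), that is, h_λ = ∑_π Ψ(h_{m̃(π)}). Both sides obey the same
recursion when a cycle of length c is added to x. On the left, h_M turns into the sum of the h_{M -
cS} over all S with cS ≤ M. On the right, Ψ(f) turns into Ψ(f + c ∂f/∂p_c), and c ∂/∂p_c removes c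
copies of a block S from π. For s̃_λ, expand the Jacobi–Trudi determinant of (N - n, λ) along its
first row. The minor multiplying h_{N-m} is a combination of the h_μ with μ ⊢ m, so its coefficients
are, up to sign, the required entries of K⁻¹. Replacing every h_{N-m} by 1 gives a determinant with
a row of ones, which equals s_λ with p_k replaced by p_k - 1. Hence s̃_λ = Ψ(s_λ[p_k ↦ p_k - 1])
(`sTilde_eq_of_hTilde_eq`). Reading K⁻¹ off such an expansion uses orthonormality of the Schur
functions (`hall_schur_schur`), proved by the bialternant formula. Finally s_λ = ∑ χ^λ(γ) p_γ / z_γ,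
and Ψ sends ∏ (p_i - 1)^{m_i} to 𝐩_γ by the binomial theorem. -/

/-- The weighted degree of an exponent, where `p_k` has degree `k`. -/
noncomputable def wt : (ℕ+ →₀ ℕ) →+ ℕ := Finsupp.weight fun k : ℕ+ => (k : ℕ)

theorem wt_single (k : ℕ+) (e : ℕ) : wt (Finsupp.single k e) = e * k := by
  simp [wt, Finsupp.weight_apply]

theorem wt_eq_sum (a : ℕ+ →₀ ℕ) : wt a = a.sum fun k e => e * (k : ℕ) := by
  simp [wt, Finsupp.weight_apply]

/-- The exponent of `p_γ`. -/
noncomputable def mon {n : ℕ} (γ : n.Partition) : ℕ+ →₀ ℕ :=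
  Multiset.toFinsupp (γ.parts.map Nat.toPNat')

theorem map_toPNat {n : ℕ} (γ : n.Partition) :
    (γ.parts.map Nat.toPNat').map (fun k : ℕ+ => (k : ℕ)) = γ.parts := by
  rw [Multiset.map_map]
  conv_rhs => rw [← Multiset.map_id γ.parts]
  refine Multiset.map_congr rfl fun i hi => ?_
  simp only [Function.comp, Nat.toPNat'_coe, γ.parts_pos hi, if_true, id]

theorem mon_apply {n : ℕ} (γ : n.Partition) (k : ℕ+) : mon γ k = γ.parts.count (k : ℕ) := by
  conv_rhs => rw [← map_toPNat γ]
  rw [mon, Multiset.toFinsupp_apply, Multiset.count_map_eq_count' _ _ PNat.coe_injective]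

theorem mon_injective {n : ℕ} : Function.Injective (mon (n := n)) := by
  intro γ δ hh
  apply Nat.Partition.ext
  rw [← map_toPNat γ, ← map_toPNat δ, Multiset.toFinsupp.injective hh]

theorem wt_toFinsupp (s : Multiset ℕ+) :
    wt (Multiset.toFinsupp s) = (s.map fun k : ℕ+ => (k : ℕ)).sum := by
  induction s using Multiset.induction with
  | empty => simp
  | cons k s ih =>
    rw [← Multiset.singleton_add, map_add, map_add, ih, Multiset.toFinsupp_singleton, wt_single]
    simp

theorem wt_mon {n : ℕ} (γ : n.Partition) : wt (mon γ) = n := by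
  rw [mon, wt_toFinsupp, map_toPNat, γ.parts_sum]

theorem exists_mon_eq {n : ℕ} {a : ℕ+ →₀ ℕ} (ha : wt a = n) : ∃ γ : n.Partition, mon γ = a := by
  refine ⟨⟨(Finsupp.toMultiset a).map (fun k : ℕ+ => (k : ℕ)), ?_, ?_⟩, ?_⟩
  · intro i hi
    obtain ⟨k, -, rfl⟩ := Multiset.mem_map.1 hi
    exact k.pos
  · rw [← wt_toFinsupp, Finsupp.toMultiset_toFinsupp, ha]
  · rw [mon, Multiset.map_map]
    simp

theorem prod_count_eq {M : Type*} [CommMonoid M] {n : ℕ} (γ : n.Partition) (g : ℕ → ℕ → M)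
    (hg : ∀ i, g i 0 = 1) :
    ∏ i ∈ Finset.Icc 1 n, g i (γ.parts.count i) = (mon γ).prod fun k e => g k e := by
  symm
  refine Finset.prod_of_injOn (fun k : ℕ+ => (k : ℕ)) (PNat.coe_injective.injOn) ?_ ?_ ?_
  · intro k hk
    have hk' := Finsupp.mem_support_iff.1 (Finset.mem_coe.1 hk)
    rw [mon_apply] at hk'
    have hmem := Multiset.count_ne_zero.1 hk'
    exact Finset.mem_coe.2 (Finset.mem_Icc.2 ⟨k.pos, γ.le_of_mem_parts hmem⟩)
  · intro i hi hi'
    have hi1 := (Finset.mem_Icc.1 hi).1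
    have : γ.parts.count i = 0 := by
      by_contra hne
      have hi2 : (i.toPNat' : ℕ) = i := by simp [Nat.toPNat'_coe, show 0 < i from hi1]
      refine hi' ⟨i.toPNat', Finset.mem_coe.2 (Finsupp.mem_support_iff.2 ?_), hi2⟩
      rwa [mon_apply, hi2]
    rw [this, hg]
  · intro k _
    simp only [mon_apply]

theorem pPart_eq_monomial {n : ℕ} (γ : n.Partition) : pPart γ = monomial (mon γ) 1 := by
  have key : ∀ s : Multiset ℕ, (s.map p).prod =
      monomial (Multiset.toFinsupp (s.map Nat.toPNat')) (1 : ℚ) := by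
    intro s
    induction s using Multiset.induction with
    | empty => simp
    | cons k s ih =>
      rw [Multiset.map_cons, Multiset.prod_cons, ih, Multiset.map_cons, ← Multiset.singleton_add,
        map_add, Multiset.toFinsupp_singleton, p, X, monomial_mul, one_mul]
  exact key _

/-- The square norm of the monomial with exponent `a` for the Hall inner product. -/
noncomputable def zf (a : ℕ+ →₀ ℕ) : ℚ := a.prod fun i e => (e.factorial : ℚ) * (i : ℚ) ^ e

theorem z_eq_zf {n : ℕ} (γ : n.Partition) : z γ = zf (mon γ) := by
  rw [z, prod_count_eq γ (fun i e => (e.factorial : ℚ) * (i : ℚ) ^ e) (by simp)]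
  rfl

theorem zf_ne_zero (a : ℕ+ →₀ ℕ) : zf a ≠ 0 := by
  refine Finset.prod_ne_zero_iff.2 fun i _ => ?_
  have : (i : ℚ) ≠ 0 := by exact_mod_cast i.ne_zero
  positivity

theorem zf_add_single (a : ℕ+ →₀ ℕ) (k : ℕ+) :
    zf (a + Finsupp.single k 1) = zf a * ((a k + 1) * k) := by
  have h0 : ∀ i : ℕ+, ((Nat.factorial 0 : ℕ) : ℚ) * (i : ℚ) ^ 0 = 1 := by simp
  rw [zf, zf, ← Finsupp.mul_prod_erase' _ k _ h0, ← Finsupp.mul_prod_erase' a k _ h0,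
    Finsupp.erase_add, Finsupp.erase_single, add_zero]
  simp only [Finsupp.add_apply, Finsupp.single_eq_same, Nat.factorial_succ, pow_succ]
  push_cast
  ring

theorem coeff_h (n : ℕ) (a : ℕ+ →₀ ℕ) :
    (h n).coeff a = if wt a = n then (zf a)⁻¹ else 0 := by
  rw [h, coeff_sum]
  simp only [pPart_eq_monomial, coeff_smul, coeff_monomial, z_eq_zf]
  split_ifs with ha
  · obtain ⟨γ, rfl⟩ := exists_mon_eq ha
    rw [Finset.sum_eq_single γ]
    · simp
    · intro δ _ hδ
      rw [if_neg fun hh => hδ (mon_injective hh), smul_zero]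
    · simp
  · refine Finset.sum_eq_zero fun γ _ => ?_
    rw [if_neg fun hh => ha (by rw [← hh, wt_mon]), smul_zero]

theorem wt_eq_zero {a : ℕ+ →₀ ℕ} (ha : wt a = 0) : a = 0 := by
  ext k
  by_contra hk
  have hk' : k ∈ a.support := Finsupp.mem_support_iff.2 hk
  rw [wt_eq_sum, Finsupp.sum, Finset.sum_eq_zero_iff] at ha
  have := ha k hk'
  simp_all

theorem h_zero : h 0 = 1 := by
  ext a
  rw [coeff_h, coeff_one]
  split_ifs with h1 h2 h2
  · subst h2; simp [zf]
  · exact absurd (wt_eq_zero h1).symm h2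
  · subst h2; simp at h1
  · rfl

theorem hInt_natCast (n : ℕ) : hInt n = h n := by simp [hInt]

theorem hInt_of_neg {k : ℤ} (hk : k < 0) : hInt k = 0 := by simp [hInt, hk]

/-! ### Adjoints of the power sums and Newton's identity. -/

/-- The adjoint `k ∂/∂p_k` of multiplication by `p_k`. -/
noncomputable def perp (k : ℕ+) : Derivation ℚ SymFun SymFun := (k : ℚ) • pderiv k

theorem coeff_perp (k : ℕ+) (f : SymFun) (a : ℕ+ →₀ ℕ) :
    coeff a (perp k f) = k * (a k + 1) * coeff (a + Finsupp.single k 1) f := by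
  rw [perp, Derivation.smul_apply, coeff_smul, coeff_pderiv, smul_eq_mul]
  ring

/-- Since ∑ h_n tⁿ = exp(∑ p_k tᵏ / k), the operator k ∂/∂p_k multiplies the series by tᵏ. In
coefficients, the factor k (a_k + 1) it produces is the ratio of consecutive values of `zf`. -/
theorem perp_hInt (k : ℕ+) (n : ℤ) : perp k (hInt n) = hInt (n - k) := by
  rcases lt_or_ge n 0 with hn | hn
  · rw [hInt_of_neg hn, hInt_of_neg (by have := k.pos; omega), map_zero]
  lift n to ℕ using hn
  rw [hInt_natCast]
  have hk : (k : ℚ) ≠ 0 := by exact_mod_cast k.ne_zero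
  ext a
  rw [coeff_perp, coeff_h, map_add, wt_single, one_mul]
  rcases lt_or_ge (n : ℤ) k with hlt | hge
  · rw [hInt_of_neg (by omega), if_neg (by omega)]; simp
  · rw [show (n : ℤ) - k = ((n - k : ℕ) : ℤ) by omega, hInt_natCast, coeff_h]
    by_cases hw : wt a = n - k
    · rw [if_pos (by omega), if_pos hw, zf_add_single]
      have := zf_ne_zero a
      have h3 : (a k : ℚ) + 1 ≠ 0 := by positivity
      field_simp
    · rw [if_neg (by omega), if_neg hw, mul_zero]

theorem coeff_X_mul_perp (k : ℕ+) (f : SymFun) (a : ℕ+ →₀ ℕ) :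
    coeff a (X k * perp k f) = k * a k * coeff a f := by
  rw [coeff_X_mul']
  split_ifs with hk
  · have h1 : 1 ≤ a k := Nat.one_le_iff_ne_zero.2 (Finsupp.mem_support_iff.1 hk)
    rw [coeff_perp, tsub_add_cancel_of_le (Finsupp.single_le_iff.2 h1)]
    congr 2
    rw [Finsupp.tsub_apply, Finsupp.single_eq_same, Nat.cast_sub h1]
    push_cast; ring
  · rw [Finsupp.notMem_support_iff.1 hk]; simp

/-- Newton's identity `n h_n = ∑_{k=1}^n p_k h_{n-k}`. -/
theorem newton (n : ℕ) :
    (n : SymFun) * h n =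
      ∑ x ∈ Finset.HasAntidiagonal.antidiagonal n, (if x.1 = 0 then 0 else p x.1) * h x.2 := by
  -- As h_{n-k} is `perp k` of h_n, the right side is ∑ p_k · k ∂/∂p_k applied to h_n: the Euler
  -- operator, multiplying each coefficient by its weight n.
  have hterm : ∀ x ∈ Finset.HasAntidiagonal.antidiagonal n,
      (if x.1 = 0 then 0 else p x.1) * h x.2 =
      if x.1 = 0 then 0 else X x.1.toPNat' * perp x.1.toPNat' (h n) := by
    rintro ⟨k, m⟩ hx
    rw [Finset.HasAntidiagonal.mem_antidiagonal] at hx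
    dsimp only at hx ⊢
    split_ifs with hk
    · rw [zero_mul]
    · rw [← hInt_natCast n, perp_hInt, ← hInt_natCast m, p]
      congr 2
      simp [Nat.pos_of_ne_zero hk]
      omega
  rw [Finset.sum_congr rfl hterm]
  ext a
  rw [coeff_sum, ← map_natCast (C : ℚ →+* SymFun), coeff_C_mul]
  have hterm2 : ∀ x ∈ Finset.HasAntidiagonal.antidiagonal n,
      coeff a (if x.1 = 0 then 0 else X x.1.toPNat' * perp x.1.toPNat' (h n) : SymFun) =
      ((if x.1 = 0 then 0 else a x.1.toPNat' * x.1 : ℕ) : ℚ) * coeff a (h n) := by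
    rintro ⟨k, m⟩ -
    dsimp only
    split_ifs with hk
    · simp
    · rw [coeff_X_mul_perp]
      push_cast
      simp only [Nat.toPNat'_coe, Nat.pos_of_ne_zero hk, if_true]
      ring
  rw [Finset.sum_congr rfl hterm2, ← Finset.sum_mul, coeff_h]
  split_ifs with hw
  · congr 1
    rw [← Nat.cast_sum, Nat.cast_inj,
      Finset.Nat.sum_antidiagonal_eq_sum_range_succ_mk, ← hw, wt_eq_sum]
    refine Finset.sum_of_injOn (fun k : ℕ+ => (k : ℕ)) (PNat.coe_injective.injOn) ?_ ?_ ?_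
    · intro k hk
      have hk' := Finsupp.mem_support_iff.1 (Finset.mem_coe.1 hk)
      have : a k * k ≤ a.sum fun k e => e * (k : ℕ) :=
        Finset.single_le_sum (f := fun k => a k * (k : ℕ)) (fun _ _ => Nat.zero_le _)
          (Finset.mem_coe.1 hk)
      refine Finset.mem_coe.2 (Finset.mem_range.2 (Nat.lt_succ_of_le (le_trans ?_ this)))
      exact Nat.le_mul_of_pos_left _ (Nat.pos_of_ne_zero hk')
    · intro i hi hi'
      dsimp only
      split_ifs with h0
      · rfl
      · rw [mul_eq_zero]; left
        by_contra hne
        exact hi' ⟨i.toPNat', Finset.mem_coe.2 (Finsupp.mem_support_iff.2 hne), by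
          simp [Nat.pos_of_ne_zero h0]⟩
    · intro k _
      simp [k.ne_zero]
  · simp

/-! ### The generating series of the `h_n` -/

section Shift

variable {R : Type*} [CommRing R]

/-- As P has no constant term, the equation expresses (n + 1) times the coefficient of degree n + 1
through lower ones, and n + 1 is invertible. -/
theorem powerSeries_ext_of_derivative [Algebra ℚ R] {G H P : PowerSeries R}
    (h0 : PowerSeries.coeff 0 G = PowerSeries.coeff 0 H) (hP : PowerSeries.coeff 0 P = 0)
    (hG : PowerSeries.X * PowerSeries.derivative R G = P * G)
    (hH : PowerSeries.X * PowerSeries.derivative R H = P * H) : G = H := by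
  ext n
  induction n using Nat.strong_induction_on with
  | _ n ih =>
    rcases n with _ | n
    · exact h0
    have e1 := congrArg (PowerSeries.coeff (n + 1)) hG
    have e2 := congrArg (PowerSeries.coeff (n + 1)) hH
    rw [PowerSeries.coeff_succ_X_mul, PowerSeries.coeff_derivative, PowerSeries.coeff_mul] at e1 e2
    have e3 : ∑ x ∈ Finset.HasAntidiagonal.antidiagonal (n + 1),
          PowerSeries.coeff x.1 P * PowerSeries.coeff x.2 G =
        ∑ x ∈ Finset.HasAntidiagonal.antidiagonal (n + 1),
          PowerSeries.coeff x.1 P * PowerSeries.coeff x.2 H := by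
      refine Finset.sum_congr rfl fun x hx => ?_
      rw [Finset.HasAntidiagonal.mem_antidiagonal] at hx
      rcases Nat.eq_zero_or_pos x.1 with hx1 | hx1
      · rw [hx1, hP, zero_mul, zero_mul]
      · rw [ih x.2 (by omega)]
    rw [e3, ← e2] at e1
    have hu : IsUnit ((n : R) + 1) := by
      have : ((n : R) + 1) = algebraMap ℚ R (n + 1) := by simp
      rw [this]
      exact (isUnit_iff_ne_zero.2 (by positivity)).map _
    exact hu.mul_left_injective e1

/-- The series `∑ φ(h_n) tⁿ`. -/
noncomputable def hSeries (φ : SymFun →+* R) : PowerSeries R := PowerSeries.mk fun n => φ (h n)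

/-- The series `∑_{k ≥ 1} φ(p_k) tᵏ`. -/
noncomputable def pSeries (φ : SymFun →+* R) : PowerSeries R :=
  PowerSeries.mk fun n => if n = 0 then 0 else φ (p n)

theorem X_mul_derivative_hSeries (φ : SymFun →+* R) :
    PowerSeries.X * PowerSeries.derivative R (hSeries φ) = pSeries φ * hSeries φ := by
  ext n
  have hn := congrArg φ (newton n)
  rw [map_mul, map_natCast, map_sum] at hn
  have hr : PowerSeries.coeff n (pSeries φ * hSeries φ) = n * φ (h n) := by
    rw [hn, PowerSeries.coeff_mul]
    refine Finset.sum_congr rfl fun x _ => ?_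
    simp only [pSeries, hSeries, PowerSeries.coeff_mk, map_mul]
    split_ifs <;> simp
  rw [hr]
  rcases n with _ | n
  · simp
  · rw [PowerSeries.coeff_succ_X_mul, PowerSeries.coeff_derivative, hSeries, PowerSeries.coeff_mk]
    push_cast; ring

/-- Here V plays the role of exp(∑ (ψ(p_k) - φ(p_k)) tᵏ / k), recognised by its constant term and
logarithmic derivative. -/
theorem hSeries_mul_eq [Algebra ℚ R] {φ ψ : SymFun →+* R} {V : PowerSeries R}
    (hV : PowerSeries.coeff 0 V = 1)
    (hd : PowerSeries.X * PowerSeries.derivative R V = (pSeries ψ - pSeries φ) * V) :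
    hSeries φ * V = hSeries ψ := by
  refine powerSeries_ext_of_derivative (P := pSeries ψ) ?_ ?_ ?_ (X_mul_derivative_hSeries ψ)
  · rw [PowerSeries.coeff_mul]
    simp [hSeries, h_zero, hV]
  · simp [pSeries]
  · rw [Derivation.leibniz, smul_eq_mul, smul_eq_mul, mul_add, mul_left_comm, hd,
      mul_left_comm _ V, X_mul_derivative_hSeries]
    ring

/-- The effect on the generating series of the `h_n` of adding `c u^{k/c}` to the `p_k`
with `c ∣ k`. -/
theorem hSeries_of_shift [Algebra ℚ R] {φ ψ : SymFun →+* R} (c : ℕ) (hc : 0 < c) (u : R)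
    (hφ : ∀ k, 0 < k → φ (p k) = ψ (p k) + if c ∣ k then c * u ^ (k / c) else 0) :
    hSeries φ * (1 - PowerSeries.C u * PowerSeries.X ^ c) = hSeries ψ := by
  apply hSeries_mul_eq
  · simp [hc.ne']
  -- The geometric series ∑_{j ≥ 1} c uʲ t^{cj} telescopes against 1 - u t^c.
  · have hu : (pSeries φ - pSeries ψ) * (1 - PowerSeries.C u * PowerSeries.X ^ c) =
        PowerSeries.C ((c : R) * u) * PowerSeries.X ^ c := by
      ext m
      rw [mul_sub, mul_one, ← mul_assoc, map_sub, PowerSeries.coeff_mul_X_pow',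
        PowerSeries.coeff_mul_C, PowerSeries.coeff_C_mul, PowerSeries.coeff_X_pow]
      have hcoef : ∀ m, PowerSeries.coeff m (pSeries φ - pSeries ψ) =
          if m = 0 then 0 else if c ∣ m then c * u ^ (m / c) else 0 := by
        intro m
        rw [map_sub, pSeries, pSeries, PowerSeries.coeff_mk, PowerSeries.coeff_mk]
        split_ifs with h0 h1
        · simp
        · rw [hφ m (by omega), if_pos h1]; ring
        · rw [hφ m (by omega), if_neg h1]; ring
      rw [hcoef, hcoef]
      rcases lt_trichotomy m c with hm | rfl | hm
      · rw [if_neg (show ¬ c ≤ m by omega), if_neg hm.ne]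
        split_ifs with h0 h1
        · simp
        · exact absurd (Nat.le_of_dvd (by omega) h1) (by omega)
        · simp
      · simp [hc.ne', Nat.div_self hc]
      · have hd : c ∣ m - c ↔ c ∣ m := by
          rw [Nat.dvd_sub_iff_left hm.le dvd_rfl]
        rw [if_pos hm.le, if_neg (show m ≠ 0 by omega), if_neg (show m - c ≠ 0 by omega),
          if_neg hm.ne']
        simp only [hd]
        split_ifs with h1
        · obtain ⟨q, rfl⟩ := h1
          obtain ⟨q, rfl⟩ : ∃ r, q = r + 1 := ⟨q - 1, by
            rcases q with _ | q
            · simp at hm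
            · rfl⟩
          rw [show c * (q + 1) - c = c * q by rw [mul_add]; omega, Nat.mul_div_cancel_left _ hc,
            Nat.mul_div_cancel_left _ hc]
          ring
        · simp
    have hd : PowerSeries.X * PowerSeries.derivative R (1 - PowerSeries.C u * PowerSeries.X ^ c) =
        - (PowerSeries.C ((c : R) * u) * PowerSeries.X ^ c) := by
      ext m
      rcases m with _ | m
      · simp [hc.ne']
      · rw [PowerSeries.coeff_succ_X_mul, PowerSeries.coeff_derivative, map_neg, map_sub,
          PowerSeries.coeff_C_mul, PowerSeries.coeff_C_mul, PowerSeries.coeff_X_pow,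
          PowerSeries.coeff_one]
        rw [if_neg (Nat.succ_ne_zero m)]
        split_ifs with h2
        · rw [← h2]; push_cast; ring
        · simp
    rw [hd, ← hu]
    ring

theorem map_h_of_shift [Algebra ℚ R] {φ ψ : SymFun →+* R} (c : ℕ) (hc : 0 < c) (u : R)
    (hφ : ∀ k, 0 < k → φ (p k) = ψ (p k) + if c ∣ k then c * u ^ (k / c) else 0) (n : ℕ) :
    ψ (h n) = φ (h n) - if c ≤ n then u * φ (h (n - c)) else 0 := by
  have := congrArg (PowerSeries.coeff n) (hSeries_of_shift c hc u hφ)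
  rw [mul_sub, mul_one, mul_left_comm, map_sub, PowerSeries.coeff_C_mul,
    PowerSeries.coeff_mul_X_pow', hSeries, hSeries, PowerSeries.coeff_mk, PowerSeries.coeff_mk,
    PowerSeries.coeff_mk] at this
  rw [← this]
  split_ifs <;> simp

end Shift

/-! ### Rows of partitions -/

theorem row_eq_zero {n : ℕ} (lam : n.Partition) {i : ℕ} (hi : lam.parts.card ≤ i) :
    row lam i = 0 := by
  rw [row, List.getD_eq_default]
  simpa using hi

theorem row_antitone {n : ℕ} (lam : n.Partition) : Antitone (row lam) := by
  intro i j hij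
  rcases hij.eq_or_lt with rfl | hlt
  · exact le_rfl
  rcases lt_or_ge j lam.parts.card with hj | hj
  · have hj' : j < (lam.parts.sort (· ≥ ·)).length := by simpa using hj
    rw [row, row, List.getD_eq_getElem _ _ hj', List.getD_eq_getElem _ _ (hlt.trans hj')]
    exact List.pairwise_iff_getElem.1 (Multiset.pairwise_sort lam.parts (· ≥ ·)) i j _ hj' hlt
  · rw [row_eq_zero lam hj]; exact Nat.zero_le _

theorem card_parts_le {n : ℕ} (lam : n.Partition) : lam.parts.card ≤ n := by
  conv_rhs => rw [← lam.parts_sum]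
  have := Multiset.card_nsmul_le_sum (s := lam.parts) (a := 1) fun x hx => lam.parts_pos hx
  simpa using this

theorem eq_of_row_eq {n : ℕ} {lam mu : n.Partition} (hrow : ∀ i < n, row lam i = row mu i) :
    lam = mu := by
  have key : ∀ lam mu : n.Partition, (∀ i < n, row lam i = row mu i) →
      lam.parts.card ≤ mu.parts.card := by
    intro lam mu hrow
    by_contra hlt
    have h1 := row_pos lam (i := mu.parts.card) (by omega)
    rw [hrow _ (by have := card_parts_le lam; omega), row_eq_zero mu le_rfl] at h1
    exact lt_irrefl _ h1
  have hcard := le_antisymm (key lam mu hrow) (key mu lam fun i hi => (hrow i hi).symm)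
  apply Nat.Partition.ext
  rw [← map_row lam, ← map_row mu, hcard]
  refine Multiset.map_congr rfl fun i hi => hrow i ?_
  have := card_parts_le mu
  have := Multiset.mem_range.1 hi
  omega

/-! ### Jacobi–Trudi determinants of larger size -/

/-- The determinant `det [h_{r_i - i + j}]` of size `L`. -/
noncomputable def jacobiTrudi (L : ℕ) (r : ℕ → ℕ) : SymFun :=
  Matrix.det (Matrix.of fun i j : Fin L => hInt ((r i : ℤ) - (i : ℤ) + (j : ℤ)))

/-- The last row consists of h_{j-L}: zeros, then h_0 = 1 on the diagonal. -/
theorem jacobiTrudi_succ {L : ℕ} {r : ℕ → ℕ} (hr : r L = 0) :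
    jacobiTrudi (L + 1) r = jacobiTrudi L r := by
  rw [jacobiTrudi, Matrix.det_succ_row _ (Fin.last L), Fin.sum_univ_castSucc,
    Finset.sum_eq_zero, zero_add]
  · simp only [Fin.val_last, Matrix.of_apply, hr, Fin.succAbove_last]
    have h1 : hInt (((0 : ℕ) : ℤ) - (L : ℤ) + (L : ℤ)) = 1 := by
      simpa [h_zero] using hInt_natCast 0
    rw [h1, (Even.add_self L).neg_one_pow, one_mul, one_mul]
    rfl
  · intro j _
    simp only [Fin.val_last, Matrix.of_apply, hr, Fin.val_castSucc]
    rw [hInt_of_neg (by have := j.2; push_cast; omega)]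
    ring

theorem schur_eq_jacobiTrudi {n : ℕ} (lam : n.Partition) {L : ℕ} (hL : lam.parts.card ≤ L) :
    schur lam = jacobiTrudi L (row lam) := by
  induction L, hL using Nat.le_induction with
  | base => rfl
  | succ L hL ih => rw [ih, jacobiTrudi_succ (row_eq_zero lam hL)]

theorem jacobiTrudi_zero (L : ℕ) : jacobiTrudi L (fun _ => 0) = 1 := by
  induction L with
  | zero => simp [jacobiTrudi]
  | succ L ih => rw [jacobiTrudi_succ rfl, ih]

/-! ### The Hall inner product -/

/-- `⟨f, ·⟩` as a linear form. -/
noncomputable def hallForm (f : SymFun) : SymFun →ₗ[ℚ] ℚ :=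
  ∑ a ∈ f.support, (f.coeff a * zf a) • lcoeff ℚ a

theorem hall_eq_hallForm (f g : SymFun) : hall f g = hallForm f g := by
  simp only [hall, hallForm, LinearMap.sum_apply, LinearMap.smul_apply, smul_eq_mul,
    lcoeff_apply]
  exact Finset.sum_congr rfl fun a _ => by rw [zf]; ring

theorem hall_eq_sum {f : SymFun} (g : SymFun) {S : Finset (ℕ+ →₀ ℕ)} (hS : f.support ⊆ S) :
    hall f g = ∑ a ∈ S, f.coeff a * g.coeff a * zf a := by
  refine Finset.sum_subset hS fun a _ ha => ?_
  rw [notMem_support_iff.1 ha, zero_mul, zero_mul]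

theorem hall_add_left (f f' g : SymFun) : hall (f + f') g = hall f g + hall f' g := by
  classical
  rw [hall_eq_sum g support_add, hall_eq_sum g (Finset.subset_union_left (s₂ := f'.support)),
    hall_eq_sum g (Finset.subset_union_right (s₁ := f.support)), ← Finset.sum_add_distrib]
  exact Finset.sum_congr rfl fun a _ => by rw [coeff_add]; ring

theorem hall_monomial (a : ℕ+ →₀ ℕ) (c : ℚ) (g : SymFun) :
    hall (monomial a c) g = c * g.coeff a * zf a := by
  classical
  rw [hall_eq_sum g support_monomial_subset, Finset.sum_singleton, coeff_monomial, if_pos rfl]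

theorem hall_mul_X (k : ℕ+) (f g : SymFun) : hall (f * X k) g = hall f (perp k g) := by
  induction f using MvPolynomial.induction_on' with
  | monomial a c =>
    rw [X, monomial_mul, mul_one, hall_monomial, hall_monomial, coeff_perp, zf_add_single]
    ring
  | add f f' hf hf' => rw [add_mul, hall_add_left, hall_add_left, hf, hf']

theorem hall_pPart {n : ℕ} (f : SymFun) (γ : n.Partition) :
    hall f (pPart γ) = f.coeff (mon γ) * z γ := by
  classical
  rw [hall_eq_sum _ (Finset.subset_insert (mon γ) f.support), z_eq_zf,
    Finset.sum_eq_single (mon γ)]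
  · rw [pPart_eq_monomial, coeff_monomial, if_pos rfl, mul_one]
  · intro a _ ha
    rw [pPart_eq_monomial, coeff_monomial, if_neg ha.symm]; ring
  · intro hh; simp at hh

/-- By the Leibniz rule, each term lowers the index of one factor by k. Integer indices absorb the
case where it becomes negative. -/
theorem perp_prod_hInt {ι : Type*} [DecidableEq ι] (k : ℕ+) (s : Finset ι) (α : ι → ℤ) :
    perp k (∏ i ∈ s, hInt (α i)) = ∑ i ∈ s, ∏ j ∈ s, hInt (α j - (Finsupp.single i (k : ℕ)) j) := by
  induction s using Finset.induction_on with
  | empty => simp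
  | insert i s hi ih =>
    rw [Finset.prod_insert hi, Derivation.leibniz, ih, perp_hInt, Finset.sum_insert hi,
      smul_eq_mul, smul_eq_mul, add_comm, Finset.mul_sum, Finset.prod_insert hi, mul_comm]
    congr 1
    · rw [Finsupp.single_eq_same]
      congr 1
      refine Finset.prod_congr rfl fun j hj => ?_
      rw [Finsupp.single_eq_of_ne (by rintro rfl; exact hi hj)]
      simp
    · refine Finset.sum_congr rfl fun j hj => ?_
      rw [Finset.prod_insert hi, Finsupp.single_eq_of_ne (by rintro rfl; exact hi hj)]
      simp

/-! ### Finitely many variables -/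

section Variables

variable {L : ℕ}

/-- The ring homomorphism `p_k ↦ ∑_{i ∈ S} x_i^k`. -/
noncomputable def evalVars (S : Finset (Fin L)) : SymFun →ₐ[ℚ] MvPolynomial (Fin L) ℚ :=
  aeval fun k => ∑ i ∈ S, X i ^ (k : ℕ)

theorem evalVars_p (S : Finset (Fin L)) {k : ℕ} (hk : 0 < k) :
    evalVars S (p k) = ∑ i ∈ S, X i ^ k := by
  simp [evalVars, p, hk]

/-- The coefficient of `x^α`, which is `0` if `α` has a negative entry. -/
noncomputable def coeffInt (α : Fin L → ℤ) (P : MvPolynomial (Fin L) ℚ) : ℚ :=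
  if ∀ i, 0 ≤ α i then P.coeff (Finsupp.equivFunOnFinite.symm fun i => (α i).toNat) else 0

theorem coeffInt_natCast (b : Fin L →₀ ℕ) (P : MvPolynomial (Fin L) ℚ) :
    coeffInt (fun i => (b i : ℤ)) P = P.coeff b := by
  rw [coeffInt, if_pos fun i => Int.natCast_nonneg _]
  congr 1
  ext i
  simp

theorem coeffInt_sum {ι : Type*} (s : Finset ι) (α : Fin L → ℤ)
    (P : ι → MvPolynomial (Fin L) ℚ) :
    coeffInt α (∑ i ∈ s, P i) = ∑ i ∈ s, coeffInt α (P i) := by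
  simp only [coeffInt]
  split_ifs
  · rw [coeff_sum]
  · simp

theorem coeffInt_smul (c : ℚ) (α : Fin L → ℤ) (P : MvPolynomial (Fin L) ℚ) :
    coeffInt α (c • P) = c * coeffInt α P := by
  simp only [coeffInt]
  split_ifs
  · rw [coeff_smul, smul_eq_mul]
  · simp

theorem coeffInt_monomial_mul (α : Fin L → ℤ) (b : Fin L →₀ ℕ) (P : MvPolynomial (Fin L) ℚ) :
    coeffInt α (monomial b 1 * P) = coeffInt (fun i => α i - b i) P := by
  simp only [coeffInt]
  by_cases h1 : ∀ i, 0 ≤ α i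
  · rw [if_pos h1, coeff_monomial_mul', one_mul]
    by_cases h2 : ∀ i, 0 ≤ α i - b i
    · rw [if_pos h2, if_pos]
      · congr 1
        ext i
        have := h2 i
        simp only [Finsupp.tsub_apply, Finsupp.equivFunOnFinite_symm_apply_apply]
        omega
      · intro i
        have := h2 i
        simp only [Finsupp.equivFunOnFinite_symm_apply_apply]
        omega
    · rw [if_neg h2, if_neg]
      intro hle
      refine h2 fun i => ?_
      have := hle i
      have := h1 i
      simp only [Finsupp.equivFunOnFinite_symm_apply_apply] at *
      omega
  · rw [if_neg h1, if_neg]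
    intro h2
    refine h1 fun i => ?_
    have := h2 i
    omega

theorem coeffInt_add (α : Fin L → ℤ) (P Q : MvPolynomial (Fin L) ℚ) :
    coeffInt α (P + Q) = coeffInt α P + coeffInt α Q := by
  simp only [coeffInt]
  split_ifs
  · rw [coeff_add]
  · simp

theorem constantCoeff_hInt (n : ℤ) : constantCoeff (hInt n) = if n = 0 then (1 : ℚ) else 0 := by
  rcases lt_or_ge n 0 with hn | hn
  · rw [hInt_of_neg hn, map_zero, if_neg hn.ne]
  lift n to ℕ using hn
  rw [hInt_natCast, constantCoeff_eq, coeff_h, map_zero]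
  by_cases hn : n = 0
  · subst hn; simp [zf]
  · rw [if_neg (Ne.symm hn), if_neg (by exact_mod_cast hn)]

/-- `⟨f, h_α⟩` is the coefficient of `x^α` in `f(x)`. -/
theorem hall_prod_hInt (f : SymFun) (α : Fin L → ℤ) :
    hall f (∏ i, hInt (α i)) = coeffInt α (evalVars Finset.univ f) := by
  induction f using MvPolynomial.induction_on generalizing α with
  | C c =>
    rw [C_apply, hall_monomial, ← C_apply, ← constantCoeff_eq, map_prod]
    simp only [constantCoeff_hInt]
    rw [Finset.prod_ite_zero, Finset.prod_const_one]
    have : evalVars (L := L) Finset.univ (C c) = c • 1 := by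
      rw [← algebraMap_eq, AlgHom.commutes, Algebra.algebraMap_eq_smul_one]
    rw [this, coeffInt_smul, coeffInt]
    simp only [Finset.mem_univ, true_imp_iff, coeff_one]
    by_cases h0 : ∀ i, α i = 0
    · have h1 : (0 : Fin L →₀ ℕ) = Finsupp.equivFunOnFinite.symm fun i => (α i).toNat := by
        ext i; simp [h0 i]
      rw [if_pos h0, if_pos fun i => (h0 i).ge, if_pos h1]
      simp [zf]
    · rw [if_neg h0]
      split_ifs with h1 h2
      · exfalso
        refine h0 fun i => ?_
        have h3 := DFunLike.congr_fun h2 i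
        have := h1 i
        simp only [Finsupp.equivFunOnFinite_symm_apply_apply, Finsupp.zero_apply] at h3
        omega
      · simp
      · simp
  | add f g hf hg => rw [hall_add_left, hf, hg, map_add, coeffInt_add]
  | mul_X f k hf =>
    -- Both sides become a sum over i with α_i lowered by k: on the left by adjointness, on the
    -- right because p_k is ∑ x_iᵏ.
    rw [hall_mul_X, perp_prod_hInt, hall_eq_hallForm, map_sum, map_mul]
    simp only [← hall_eq_hallForm, hf]
    have : evalVars (L := L) Finset.univ (X k) =
        ∑ i, monomial (Finsupp.single i (k : ℕ)) (1 : ℚ) := by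
      simp [evalVars, X_pow_eq_monomial]
    rw [this, mul_comm, Finset.sum_mul, coeffInt_sum]
    exact Finset.sum_congr rfl fun i _ => (coeffInt_monomial_mul _ _ _).symm

/-- The determinant `det [x_j^{r_i + L - 1 - i}]`. -/
noncomputable def alternant (L : ℕ) (r : ℕ → ℕ) : MvPolynomial (Fin L) ℚ :=
  Matrix.det (Matrix.of fun i j : Fin L => X j ^ (r i + (L - 1 - (i : ℕ))))

theorem alternant_eq_sum (r : ℕ → ℕ) : alternant L r =
    ∑ σ : Equiv.Perm (Fin L), ((Equiv.Perm.sign σ : ℤ) : ℚ) •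
      monomial (Finsupp.equivFunOnFinite.symm fun i : Fin L => r (σ i) + (L - 1 - (σ i : ℕ)))
        (1 : ℚ) := by
  rw [alternant, Matrix.det_apply']
  refine Finset.sum_congr rfl fun σ _ => ?_
  rw [monomial_eq, Finsupp.prod_fintype _ _ (by simp), C_1, one_mul, smul_eq_C_mul]
  simp

/-- `⟨f, s_λ⟩` is the coefficient of `x^{λ+δ}` in `a_δ(x) f(x)`. -/
theorem hall_jacobiTrudi (f : SymFun) (r : ℕ → ℕ) :
    hall f (jacobiTrudi L r) =
      (alternant L (fun _ => 0) * evalVars Finset.univ f).coeff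
        (Finsupp.equivFunOnFinite.symm fun i : Fin L => r i + (L - 1 - (i : ℕ))) := by
  -- The two determinants are matched permutation by permutation: the index r_i - i + σ(i) is (r_i +
  -- L - 1 - i) - (L - 1 - σ(i)).
  rw [jacobiTrudi, ← Matrix.det_transpose, Matrix.det_apply', hall_eq_hallForm, map_sum,
    alternant_eq_sum, Finset.sum_mul, coeff_sum]
  refine Finset.sum_congr rfl fun σ _ => ?_
  rw [smul_mul_assoc, coeff_smul, ← coeffInt_natCast, coeffInt_monomial_mul, smul_eq_mul]
  have hcast : ((Equiv.Perm.sign σ : ℤ) : SymFun) = C ((Equiv.Perm.sign σ : ℤ) : ℚ) := by simp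
  rw [hcast, ← smul_eq_C_mul, map_smul, smul_eq_mul, ← hall_eq_hallForm]
  congr 1
  simp only [Matrix.transpose_apply, Matrix.of_apply]
  rw [hall_prod_hInt]
  congr 1
  funext i
  have h1 := i.2
  have h2 := (σ i).2
  simp only [Finsupp.equivFunOnFinite_symm_apply_apply, zero_add]
  omega

theorem evalVars_p_insert {S : Finset (Fin L)} {i : Fin L} (hi : i ∉ S) (k : ℕ) (hk : 0 < k) :
    (evalVars (insert i S) : SymFun →+* MvPolynomial (Fin L) ℚ) (p k) =
      (evalVars S : SymFun →+* MvPolynomial (Fin L) ℚ) (p k) +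
        if 1 ∣ k then ((1 : ℕ) : MvPolynomial (Fin L) ℚ) * X i ^ (k / 1) else 0 := by
  have h1 := evalVars_p (insert i S) hk
  have h2 := evalVars_p S hk
  rw [if_pos (one_dvd k), Nat.cast_one, one_mul, Nat.div_one]
  simp only [RingHom.coe_coe] at *
  rw [h1, h2, Finset.sum_insert hi, add_comm]

/-- The generating series of the `h_n` in the variables in `S`. -/
noncomputable def hVars (S : Finset (Fin L)) : PowerSeries (MvPolynomial (Fin L) ℚ) :=
  hSeries (evalVars S : SymFun →+* MvPolynomial (Fin L) ℚ)

theorem hVars_insert {S : Finset (Fin L)} {i : Fin L} (hi : i ∉ S) :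
    hVars (insert i S) * (1 - PowerSeries.C (X i) * PowerSeries.X) = hVars S := by
  have := hSeries_of_shift 1 one_pos (X i) (evalVars_p_insert hi)
  rwa [pow_one] at this

theorem hVars_empty : hVars (∅ : Finset (Fin L)) = 1 := by
  ext1 n
  rw [hVars, hSeries, PowerSeries.coeff_mk, PowerSeries.coeff_one]
  have h1 : (evalVars (∅ : Finset (Fin L))) (h n) = C (constantCoeff (h n)) := by
    have : evalVars (∅ : Finset (Fin L)) = (Algebra.ofId ℚ _).comp (aeval fun _ => (0 : ℚ)) := by
      ext k; simp [evalVars]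
    rw [this, AlgHom.comp_apply]
    simp [Algebra.ofId_apply, algebraMap_eq, aeval_zero']
  have h2 := constantCoeff_hInt n
  rw [hInt_natCast] at h2
  rw [h2] at h1
  refine h1.trans ?_
  split_ifs <;> simp_all

theorem hVars_union (S T : Finset (Fin L)) (hST : Disjoint S T) :
    hVars (S ∪ T) * ∏ i ∈ T, (1 - PowerSeries.C (X i) * PowerSeries.X) = hVars S := by
  induction T using Finset.induction_on with
  | empty => simp
  | insert i T hi ih =>
    rw [Finset.disjoint_insert_right] at hST
    rw [Finset.prod_insert hi, ← mul_assoc, Finset.union_insert, hVars_insert, ih hST.2]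
    simp [hST.1, hi]

theorem hVars_singleton (i : Fin L) :
    hVars {i} = PowerSeries.mk fun n => (X i : MvPolynomial (Fin L) ℚ) ^ n := by
  have h1 := hVars_insert (Finset.notMem_empty i)
  rw [hVars_empty, insert_empty_eq] at h1
  ext1 n
  rw [PowerSeries.coeff_mk]
  induction n with
  | zero =>
    have := congrArg (PowerSeries.coeff 0) h1
    simpa using this
  | succ n ih =>
    have := congrArg (PowerSeries.coeff (n + 1)) h1
    rw [mul_sub, mul_one, map_sub, mul_left_comm, PowerSeries.coeff_C_mul,
      PowerSeries.coeff_succ_mul_X, ih, PowerSeries.coeff_one, if_neg (Nat.succ_ne_zero n),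
      sub_eq_zero] at this
    rw [this, pow_succ']

theorem coeff_prod_one_sub (T : Finset (Fin L)) {n : ℕ} (hn : T.card < n) :
    PowerSeries.coeff n (∏ i ∈ T, (1 - PowerSeries.C (X i : MvPolynomial (Fin L) ℚ) *
      PowerSeries.X)) = 0 := by
  induction T using Finset.induction_on generalizing n with
  | empty => simp at hn; simp [PowerSeries.coeff_one]; omega
  | insert i T hi ih =>
    rw [Finset.card_insert_of_notMem hi] at hn
    obtain ⟨n, rfl⟩ : ∃ m, n = m + 1 := ⟨n - 1, by omega⟩
    rw [Finset.prod_insert hi, sub_mul, one_mul, map_sub, mul_assoc, PowerSeries.coeff_C_mul,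
      PowerSeries.coeff_succ_X_mul, ih (by omega), ih (by omega)]
    simp

/-- The signed elementary symmetric function `(-1)^m e_m` of the variables other than `x_j`. -/
noncomputable def elemOmit (j : Fin L) (m : ℕ) : MvPolynomial (Fin L) ℚ :=
  PowerSeries.coeff m (∏ i ∈ Finset.univ.erase j, (1 - PowerSeries.C (X i) * PowerSeries.X))

/-- Coefficient of tᵃ in H(t) ∏_{i ≠ j} (1 - x_i t) = 1 / (1 - x_j t), where H is the series of the
h_n in all variables. -/
theorem sum_hInt_mul_elemOmit (j : Fin L) (a : ℕ) :
    ∑ m : Fin L, evalVars Finset.univ (hInt ((a : ℤ) - ((L - 1 - (m : ℕ) : ℕ) : ℤ))) *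
      elemOmit j (L - 1 - (m : ℕ)) = X j ^ a := by
  have h1 := congrArg (PowerSeries.coeff a)
    (hVars_union {j} (Finset.univ.erase j) (by simp))
  rw [hVars_singleton, PowerSeries.coeff_mk, mul_comm, PowerSeries.coeff_mul] at h1
  have hu : ({j} ∪ Finset.univ.erase j : Finset (Fin L)) = Finset.univ := by
    ext i; simp
  rw [hu, Finset.Nat.sum_antidiagonal_eq_sum_range_succ_mk] at h1
  rw [← h1]
  set F : ℕ → MvPolynomial (Fin L) ℚ := fun m =>
    evalVars Finset.univ (hInt ((a : ℤ) - (m : ℤ))) * elemOmit j m with hF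
  rw [Fin.sum_univ_eq_sum_range (fun m => F (L - 1 - m)), Finset.sum_range_reflect]
  -- `F m` vanishes for m ≥ L (degree of the product) and for m > a (negative index), so both ranges
  -- extend to a common one.
  have e1 : ∑ m ∈ Finset.range L, F m = ∑ m ∈ Finset.range (L + (a + 1)), F m := by
    refine Finset.sum_subset (Finset.range_mono (by omega)) fun m _ hm => ?_
    simp only [hF]
    rw [elemOmit, coeff_prod_one_sub, mul_zero]
    rw [Finset.card_erase_of_mem (Finset.mem_univ j), Finset.card_univ, Fintype.card_fin]
    have := j.2
    rw [Finset.mem_range] at hm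
    omega
  have e2 : ∑ m ∈ Finset.range (a + 1), F m = ∑ m ∈ Finset.range (L + (a + 1)), F m := by
    refine Finset.sum_subset (Finset.range_mono (by omega)) fun m _ hm => ?_
    rw [Finset.mem_range] at hm
    simp only [hF]
    rw [hInt_of_neg (by omega), map_zero, zero_mul]
  rw [e1, ← e2]
  refine Finset.sum_congr rfl fun m hm => ?_
  rw [Finset.mem_range] at hm
  simp only [hF, hVars, hSeries, PowerSeries.coeff_mk]
  rw [show (a : ℤ) - (m : ℤ) = ((a - m : ℕ) : ℤ) by omega, hInt_natCast, mul_comm]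
  rfl

/-- The bialternant formula `s_λ(x) a_δ(x) = a_{λ+δ}(x)`. -/
theorem alternant_zero_mul (r : ℕ → ℕ) :
    alternant L (fun _ => 0) * evalVars Finset.univ (jacobiTrudi L r) = alternant L r := by
  -- The alternant matrix is the Jacobi–Trudi matrix times a matrix independent of r; the case r = 0
  -- identifies the determinant of the latter with a_δ.
  have key : ∀ r : ℕ → ℕ, evalVars Finset.univ (jacobiTrudi L r) *
      Matrix.det (Matrix.of fun m j : Fin L => elemOmit j (L - 1 - (m : ℕ))) = alternant L r := by
    intro r
    rw [jacobiTrudi, AlgHom.map_det, ← Matrix.det_mul, alternant]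
    congr 1
    ext1 i j
    rw [Matrix.mul_apply, Matrix.of_apply, ← sum_hInt_mul_elemOmit]
    refine Finset.sum_congr rfl fun m _ => ?_
    simp only [AlgHom.mapMatrix_apply, Matrix.map_apply, Matrix.of_apply]
    congr 3
    have h1 := i.2
    have h2 := m.2
    omega
  have h0 := key fun _ => 0
  rw [jacobiTrudi_zero, map_one, one_mul] at h0
  rw [← h0, mul_comm, key]

end Variables

/-- Such a σ is an increasing bijection. Hence only the identity can contribute to the coefficient
of x^{λ+δ} in a_{μ+δ}. -/
theorem perm_eq_one_of_strictAnti {L : ℕ} {f g : Fin L → ℕ} (hf : StrictAnti f)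
    (hg : StrictAnti g) {σ : Equiv.Perm (Fin L)} (hσ : ∀ i, f i = g (σ i)) : σ = 1 := by
  have hmono : StrictMono σ := by
    intro i j hij
    have := hf hij
    rw [hσ, hσ] at this
    exact hg.lt_iff_gt.1 this
  have := Subsingleton.elim (hmono.orderIsoOfSurjective σ σ.surjective) (OrderIso.refl _)
  ext i
  have h1 := DFunLike.congr_fun this i
  simpa using congrArg Fin.val h1

/-- The Schur functions are orthonormal. -/
theorem hall_schur_schur {n : ℕ} (lam mu : n.Partition) :
    hall (schur mu) (schur lam) = if mu = lam then 1 else 0 := by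
  rw [schur_eq_jacobiTrudi lam (card_parts_le lam), hall_jacobiTrudi,
    schur_eq_jacobiTrudi mu (card_parts_le mu), alternant_zero_mul, alternant_eq_sum, coeff_sum]
  have hanti : ∀ nu : n.Partition,
      StrictAnti fun i : Fin n => row nu i + (n - 1 - (i : ℕ)) := by
    intro nu i j hij
    have h1 := row_antitone nu (show (i : ℕ) ≤ j from hij.le)
    have h2 : (i : ℕ) < j := hij
    have := j.2
    dsimp only
    omega
  simp only [coeff_smul, coeff_monomial, EmbeddingLike.apply_eq_iff_eq]
  rw [Finset.sum_eq_single 1]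
  · by_cases hh : mu = lam
    · subst hh; simp
    · rw [if_neg hh, if_neg, smul_zero]
      intro heq
      refine hh (eq_of_row_eq fun i hi => ?_)
      have := congrFun heq ⟨i, hi⟩
      simp only [Equiv.Perm.coe_one, id] at this
      omega
  · intro σ _ hσ
    rw [if_neg, smul_zero]
    intro heq
    exact hσ (perm_eq_one_of_strictAnti (hanti lam) (hanti mu) fun i => (congrFun heq i).symm)
  · simp

/-! ### Expansions in the basis of the `h_μ` -/

theorem hPart_ofSums {n : ℕ} (s : Multiset ℕ) (hs : s.sum = n) :
    hPart (Nat.Partition.ofSums n s hs) = (s.map h).prod := by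
  rw [hPart, Nat.Partition.ofSums_parts]
  clear hs
  induction s using Multiset.induction with
  | empty => simp
  | cons a s ih =>
    rw [Multiset.map_cons, Multiset.prod_cons, ← ih]
    by_cases ha : a = 0
    · subst ha
      rw [Multiset.filter_cons_of_neg (p := fun x : ℕ => x ≠ 0) _ (by simp), h_zero, one_mul]
    · rw [Multiset.filter_cons_of_pos (p := fun x : ℕ => x ≠ 0) _ ha, Multiset.map_cons,
        Multiset.prod_cons]

theorem prod_hInt_mem_span {k n : ℕ} (α : Fin k → ℤ) (hα : ∑ i, α i = n) :
    ∏ i, hInt (α i) ∈ Submodule.span ℚ (Set.range (hPart (n := n))) := by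
  by_cases hneg : ∃ i, α i < 0
  · obtain ⟨i, hi⟩ := hneg
    rw [Finset.prod_eq_zero (Finset.mem_univ i) (hInt_of_neg hi)]
    exact Submodule.zero_mem _
  push Not at hneg
  have h1 : ((Finset.univ : Finset (Fin k)).val.map fun i => (α i).toNat).sum = n := by
    have h2 : ((∑ i, (α i).toNat : ℕ) : ℤ) = n := by
      rw [← hα, Nat.cast_sum]
      exact Finset.sum_congr rfl fun i _ => Int.toNat_of_nonneg (hneg i)
    exact Nat.cast_injective h2
  refine Submodule.subset_span ⟨Nat.Partition.ofSums n _ h1, ?_⟩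
  rw [hPart_ofSums, Multiset.map_map]
  refine Finset.prod_congr rfl fun i _ => ?_
  rw [hInt, if_pos (hneg i)]
  rfl

/-- Every term of the Leibniz expansion has the same total index ∑ a + ∑ b. -/
theorem det_hInt_mem_span {k n : ℕ} (a b : Fin k → ℤ) (hab : ∑ i, a i + ∑ j, b j = n) :
    Matrix.det (Matrix.of fun i j => hInt (a i + b j)) ∈
      Submodule.span ℚ (Set.range (hPart (n := n))) := by
  rw [Matrix.det_apply]
  refine Submodule.sum_mem _ fun σ _ => ?_
  have hmem := prod_hInt_mem_span (n := n) (fun i => a (σ i) + b i) (by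
    rw [Finset.sum_add_distrib, Equiv.sum_comp σ a, hab])
  rcases Int.units_eq_one_or (Equiv.Perm.sign σ) with hs | hs <;> rw [hs]
  · simpa using hmem
  · simpa [Units.neg_smul] using hmem

theorem sum_row {n : ℕ} (lam : n.Partition) {L : ℕ} (hL : lam.parts.card ≤ L) :
    ∑ i : Fin L, row lam i = n := by
  rw [Fin.sum_univ_eq_sum_range (row lam),
    ← Finset.sum_subset (Finset.range_mono hL) fun i _ hi =>
      row_eq_zero lam (by simpa using hi)]
  conv_rhs => rw [← lam.parts_sum, ← map_row lam]
  rfl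

theorem schur_mem_span {n : ℕ} (lam : n.Partition) :
    schur lam ∈ Submodule.span ℚ (Set.range (hPart (n := n))) := by
  refine det_hInt_mem_span (fun i => (row lam i : ℤ) - (i : ℤ)) (fun j => (j : ℤ)) ?_
  rw [Finset.sum_sub_distrib, sub_add_cancel]
  exact_mod_cast sum_row lam le_rfl

/-- The coefficients of `s_λ` in the `h_μ` are the entries of the inverse Kostka matrix. -/
theorem eq_inv_kostka {n : ℕ} {lam : n.Partition} {c : n.Partition → ℚ}
    (hc : schur lam = ∑ μ, c μ • hPart μ) (μ : n.Partition) : c μ = (kostka n)⁻¹ μ lam := by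
  have hmul : ∀ (nu : n.Partition) (c : n.Partition → ℚ), schur nu = ∑ μ, c μ • hPart μ →
      Matrix.mulVec (kostka n) c = Pi.single nu 1 := by
    intro nu c hc
    ext rho
    have := hall_schur_schur nu rho
    rw [hc, hall_eq_hallForm, map_sum] at this
    rw [Pi.single_apply, ← this, Matrix.mulVec, dotProduct]
    refine Finset.sum_congr rfl fun μ _ => ?_
    rw [map_smul, smul_eq_mul, ← hall_eq_hallForm, kostka, Matrix.of_apply, mul_comm]
  choose A hA using fun nu : n.Partition =>
    (Submodule.mem_span_range_iff_exists_fun ℚ).1 (schur_mem_span nu)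
  -- A matrix inverse is 0 by default when the determinant is not a unit, so invertibility is
  -- needed: the coefficients of all s_ν in the h_μ form a right inverse.
  have hinv : kostka n * (Matrix.of A).transpose = 1 := by
    ext rho nu
    have := congrFun (hmul nu (A nu) (hA nu).symm) rho
    rw [Pi.single_apply] at this
    rw [Matrix.one_apply, ← this]
    rfl
  have hc' := congrArg (Matrix.mulVec (kostka n)⁻¹) (hmul lam c hc)
  rw [Matrix.mulVec_mulVec, Matrix.nonsing_inv_mul _ (Matrix.isUnit_det_of_right_inverse hinv),
    Matrix.one_mulVec, Matrix.mulVec_single_one] at hc'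
  exact congrFun hc' μ

/-! ### Adding a long first row -/

theorem hPart_addRow {m N : ℕ} (μ : m.Partition) (hm : m ≤ N) :
    hPart (addRow N μ hm) = h (N - m) * hPart μ := by
  rw [addRow, hPart_ofSums, Multiset.map_cons, Multiset.prod_cons, hPart]

/-- From 2m ≤ N, the new part N - m is at least every part of μ and sorts first. If N - m = 0 it is
dropped, but then m = 0 and all rows vanish. -/
theorem row_addRow {m N : ℕ} (μ : m.Partition) (hm : 2 * m ≤ N) (hm' : m ≤ N) :
    row (addRow N μ hm') 0 = N - m ∧ ∀ i, row (addRow N μ hm') (i + 1) = row μ i := by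
  have hfil : μ.parts.filter (· ≠ 0) = μ.parts :=
    Multiset.filter_eq_self.2 fun i hi => (μ.parts_pos hi).ne'
  by_cases h0 : N - m = 0
  · have hm0 : m = 0 := by omega
    have hparts : μ.parts = 0 := by
      have := card_parts_le μ
      exact Multiset.card_eq_zero.1 (by omega)
    have h1 : (addRow N μ hm').parts = 0 := by
      rw [addRow, Nat.Partition.ofSums_parts, h0,
        Multiset.filter_cons_of_neg (p := fun x : ℕ => x ≠ 0) _ (by simp), hfil,
        hparts]
    refine ⟨?_, fun i => ?_⟩
    · rw [row_eq_zero _ (by simp [h1]), h0]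
    · rw [row_eq_zero _ (by simp [h1]), row_eq_zero _ (by simp [hparts])]
  · have h1 : (addRow N μ hm').parts.sort (· ≥ ·) = (N - m) :: μ.parts.sort (· ≥ ·) := by
      rw [addRow, Nat.Partition.ofSums_parts,
        Multiset.filter_cons_of_pos (p := fun x : ℕ => x ≠ 0) _ h0, hfil]
      refine Multiset.sort_cons (N - m) μ.parts (· ≥ ·) fun b hb => ?_
      have := μ.le_of_mem_parts hb
      omega
    refine ⟨?_, fun i => ?_⟩ <;> simp [row, h1]

theorem card_addRow_le {m N : ℕ} (μ : m.Partition) (hm : m ≤ N) :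
    (addRow N μ hm).parts.card ≤ m + 1 := by
  rw [addRow, Nat.Partition.ofSums_parts]
  refine (Multiset.card_le_card (Multiset.filter_le _ _)).trans ?_
  rw [Multiset.card_cons]
  have := card_parts_le μ
  omega

theorem addRow_injective {n N : ℕ} (hN : 2 * n ≤ N) :
    Function.Injective fun x : Σ m : Fin (n + 1), Nat.Partition m =>
      addRow N x.2 (by omega) := by
  rintro ⟨m, μ⟩ ⟨m', μ'⟩ heq
  dsimp only at heq
  obtain ⟨h1, h2⟩ := row_addRow (N := N) μ (by omega) (by omega)
  obtain ⟨h1', h2'⟩ := row_addRow (N := N) μ' (by omega) (by omega)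
  have hmm : m = m' := by
    rw [heq, h1'] at h1
    ext
    omega
  subst hmm
  congr 1
  refine eq_of_row_eq fun i _ => ?_
  rw [← h2, ← h2', heq]

/-! ### The shift `p_k ↦ p_k - 1` -/

/-- The algebra homomorphism `p_k ↦ p_k - 1`. -/
noncomputable def shift : SymFun →ₐ[ℚ] SymFun := aeval fun k => X k - 1

theorem shift_hInt (k : ℤ) : shift (hInt k) = hInt k - hInt (k - 1) := by
  rcases lt_or_ge k 0 with hk | hk
  · rw [hInt_of_neg hk, hInt_of_neg (by omega), map_zero, sub_zero]
  lift k to ℕ using hk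
  have := map_h_of_shift (φ := RingHom.id SymFun) (ψ := (shift : SymFun →+* SymFun)) 1 one_pos 1
    (fun k hk => by simp [shift, p]) k
  rw [RingHom.coe_coe] at this
  rw [hInt_natCast, this]
  split_ifs with h1
  · rw [show (k : ℤ) - 1 = ((k - 1 : ℕ) : ℤ) by omega, hInt_natCast]
    simp
  · rw [hInt_of_neg (show (k : ℤ) - 1 < 0 by omega)]
    simp

/-- The left side expands a determinant with top row all ones; subtracting from each column its
predecessor makes that row (1, 0, …, 0). -/
theorem det_ones_row {R : Type*} [CommRing R] {n : ℕ} (M : Fin n → Fin (n + 1) → R) :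
    ∑ j : Fin (n + 1), (-1) ^ (j : ℕ) * Matrix.det (Matrix.of fun i j' => M i (j.succAbove j')) =
      Matrix.det (Matrix.of fun i j : Fin n => M i j.succ - M i j.castSucc) := by
  let A : Fin (n + 1) → Fin (n + 1) → R := Fin.cons (fun _ => 1) M
  let B : Fin (n + 1) → Fin (n + 1) → R := Fin.cons (Pi.single 0 1) fun i =>
    Fin.cons (M i 0) fun j => M i j.succ - M i j.castSucc
  have h1 := Matrix.det_succ_row_zero (Matrix.of A)
  have h2 := Matrix.det_succ_row_zero (Matrix.of B)
  rw [Matrix.det_eq_of_forall_col_eq_smul_add_pred (B := Matrix.of B) (fun _ => 1), h2,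
    Fin.sum_univ_succ, Finset.sum_eq_zero, add_zero] at h1
  · have hA : ∀ j, Matrix.of A 0 j = 1 := fun j => rfl
    have hB : Matrix.of B 0 0 = 1 := by simp [B]
    simp only [hA, hB, mul_one, Fin.val_zero, pow_zero, one_mul] at h1
    exact h1.symm
  · intro j _
    simp [B]
  · intro i
    refine Fin.cases ?_ (fun i => ?_) i <;> simp [A, B]
  · intro i j
    refine Fin.cases ?_ (fun i => ?_) i <;> simp [A, B]

/-- The minors of the Jacobi–Trudi matrix of `(N - n, λ)` along its first row. -/
noncomputable def minorRow {n : ℕ} (lam : n.Partition) (j : Fin (n + 1)) : SymFun :=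
  Matrix.det (Matrix.of fun i j' : Fin n =>
    hInt (((row lam i : ℤ) - ((i : ℤ) + 1)) + ((j.succAbove j' : ℕ) : ℤ)))

/-- The deleted column is n - m, so the total index is n - ∑_{i<n} (i + 1) + ∑_{j≤n} j - (n - m) =
m. -/
theorem minorRow_mem_span {n : ℕ} (lam : n.Partition) (m : Fin (n + 1)) :
    minorRow lam m.rev ∈ Submodule.span ℚ (Set.range (hPart (n := m))) := by
  refine det_hInt_mem_span (fun i => (row lam i : ℤ) - ((i : ℤ) + 1))
    (fun j' => ((m.rev.succAbove j' : ℕ) : ℤ)) ?_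
  have h1 := Fin.sum_univ_succAbove (fun j : Fin (n + 1) => (j : ℤ)) m.rev
  have h2 := Fin.sum_univ_succ (fun j : Fin (n + 1) => (j : ℤ))
  have h3 : (∑ i : Fin n, (row lam i : ℤ)) = n := by exact_mod_cast sum_row lam (card_parts_le lam)
  have h4 : ((m.rev : ℕ) : ℤ) = n - m := by rw [Fin.val_rev]; omega
  simp only [Fin.val_succ, Fin.val_zero] at h2
  push_cast at h2
  rw [Finset.sum_sub_distrib, h3]
  linarith

theorem schur_addRow {n N : ℕ} (lam : n.Partition) (hN : 2 * n ≤ N) (hN' : n ≤ N) :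
    schur (addRow N lam hN') =
      ∑ m : Fin (n + 1), (-1) ^ (m.rev : ℕ) * (h (N - m) * minorRow lam m.rev) := by
  obtain ⟨h1, h2⟩ := row_addRow lam hN hN'
  rw [schur_eq_jacobiTrudi _ (card_addRow_le lam hN'), jacobiTrudi, Matrix.det_succ_row_zero,
    ← Equiv.sum_comp Fin.revPerm]
  refine Finset.sum_congr rfl fun m _ => ?_
  rw [Fin.revPerm_apply, mul_assoc, Matrix.of_apply, Fin.val_zero, h1, ← hInt_natCast]
  congr 3
  · rw [Fin.val_rev]; omega
  · ext1 i j
    rw [Matrix.submatrix_apply, Matrix.of_apply, Matrix.of_apply, Fin.val_succ, h2]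
    push_cast
    rfl

/-- The shift replaces each entry h_k by h_k - h_{k-1}, a difference of adjacent columns. The result
is the expansion in `schur_addRow` with every h_{N-m} set to 1. -/
theorem shift_schur {n : ℕ} (lam : n.Partition) :
    shift (schur lam) = ∑ m : Fin (n + 1), (-1) ^ (m.rev : ℕ) * minorRow lam m.rev := by
  rw [← Equiv.sum_comp Fin.revPerm]
  simp only [Fin.revPerm_apply, Fin.rev_rev]
  refine Eq.trans ?_ (det_ones_row (fun (i : Fin n) (j : Fin (n + 1)) =>
    hInt ((row lam i : ℤ) - ((i : ℤ) + 1) + (j : ℤ)))).symm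
  rw [schur_eq_jacobiTrudi lam (card_parts_le lam), jacobiTrudi, AlgHom.map_det]
  congr 1
  ext1 i j
  rw [AlgHom.mapMatrix_apply, Matrix.map_apply, Matrix.of_apply, shift_hInt, Matrix.of_apply,
    Fin.val_succ, Fin.val_castSucc]
  congr 2 <;> push_cast <;> ring

/-- If `h̃_μ = Ψ(h_μ)` for a linear map `Ψ`, then `s̃_λ` is the image under `Ψ` of `s_λ` with
`p_k` replaced by `p_k - 1`. -/
theorem sTilde_eq_of_hTilde_eq {Ψ : SymFun →ₗ[ℚ] SymFun}
    (hΨ : ∀ {m : ℕ} (μ : m.Partition), hTilde μ = Ψ (hPart μ)) {n N : ℕ} (lam : n.Partition)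
    (hN : 2 * n ≤ N) : sTilde N lam hN = Ψ (shift (schur lam)) := by
  choose c hc using fun m : Fin (n + 1) =>
    (Submodule.mem_span_range_iff_exists_fun ℚ).1 (minorRow_mem_span lam m)
  -- The expansion is regrouped by partitions of N; by `addRow_injective` each ν receives at most
  -- one term.
  have hs : schur (addRow N lam (by omega)) = ∑ ν : N.Partition,
      (∑ x : Σ m : Fin (n + 1), Nat.Partition m,
        if addRow N x.2 (by omega) = ν then (-1) ^ (x.1.rev : ℕ) * c x.1 x.2 else 0) • hPart ν := by
    rw [schur_addRow lam hN]
    simp only [Finset.sum_smul, ite_smul, zero_smul]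
    rw [Finset.sum_comm]
    simp only [Finset.sum_ite_eq, Finset.mem_univ, if_true]
    rw [Fintype.sum_sigma]
    refine Finset.sum_congr rfl fun m _ => ?_
    rw [← hc, Finset.mul_sum, Finset.mul_sum]
    refine Finset.sum_congr rfl fun μ _ => ?_
    rw [hPart_addRow, mul_smul, mul_smul_comm, mul_smul_comm, smul_comm, smul_eq_C_mul _ ((-1) ^ _)]
    simp
  have hcoef : ∀ x : Σ m : Fin (n + 1), Nat.Partition m,
      (kostka N)⁻¹ (addRow N x.2 (by omega)) (addRow N lam (by omega)) =
        (-1) ^ (x.1.rev : ℕ) * c x.1 x.2 := by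
    intro x
    rw [← eq_inv_kostka hs, Finset.sum_eq_single x]
    · rw [if_pos rfl]
    · intro y _ hy
      exact if_neg fun heq => hy (addRow_injective hN heq)
    · simp
  rw [sTilde, shift_schur, map_sum]
  refine Finset.sum_congr rfl fun m _ => ?_
  rw [← hc, Finset.mul_sum, map_sum]
  refine Finset.sum_congr rfl fun μ _ => ?_
  rw [hcoef ⟨m, μ⟩, hΨ, ← map_smul]
  congr 1
  rw [mul_smul, mul_smul_comm, smul_comm, smul_eq_C_mul _ ((-1) ^ _)]
  simp

/-! ### Values at cycle types -/

/-- The value `∑_{c ∣ k} c` of `p_k` at a permutation with cycle type `x`. -/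
noncomputable def cyclePower (x : Multiset ℕ+) (k : ℕ) : ℚ :=
  (x.map fun c : ℕ+ => if (c : ℕ) ∣ k then (c : ℚ) else 0).sum

theorem cyclePower_cons (c : ℕ+) (x : Multiset ℕ+) (k : ℕ) :
    cyclePower (c ::ₘ x) k = cyclePower x k + if (c : ℕ) ∣ k then (c : ℚ) else 0 := by
  rw [cyclePower, Multiset.map_cons, Multiset.sum_cons, add_comm, cyclePower]

/-- Evaluation of a symmetric function at a permutation with cycle type `x`. -/
noncomputable def evalCycle (x : Multiset ℕ+) : SymFun →ₐ[ℚ] ℚ := aeval fun k => cyclePower x k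

theorem evalCycle_p (x : Multiset ℕ+) {k : ℕ} (hk : 0 < k) :
    evalCycle x (p k) = cyclePower x k := by
  simp [evalCycle, p, hk]

theorem cyclePower_eq_sum (x : Multiset ℕ+) {k : ℕ} (hk : 0 < k) :
    cyclePower x k = ∑ d ∈ k.divisors, (d : ℚ) * (x.count d.toPNat' : ℚ) := by
  induction x using Multiset.induction with
  | empty => simp [cyclePower]
  | cons c x ih =>
    have hterm : ∀ d ∈ k.divisors, (d : ℚ) * ((c ::ₘ x).count d.toPNat' : ℚ) =
        (d : ℚ) * (x.count d.toPNat' : ℚ) + if (c : ℕ) = d then (d : ℚ) else 0 := by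
      intro d hd
      have hd0 : 0 < d := Nat.pos_of_mem_divisors hd
      have hiff : d.toPNat' = c ↔ (c : ℕ) = d := by
        rw [← PNat.coe_inj, Nat.toPNat'_coe, if_pos hd0, eq_comm]
      rw [Multiset.count_cons]
      simp only [hiff]
      split_ifs <;> push_cast <;> ring
    rw [cyclePower_cons, ih, Finset.sum_congr rfl hterm, Finset.sum_add_distrib,
      Finset.sum_ite_eq]
    simp [Nat.mem_divisors, hk.ne']

theorem sum_divisors_cyc {k : ℕ} (hk : 0 < k) :
    ∑ d ∈ k.divisors, (d : SymFun) * cyc d = p k := by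
  refine (ArithmeticFunction.sum_eq_iff_sum_mul_moebius_eq
    (f := fun d => (d : SymFun) * cyc d) (g := p)).2 ?_ k hk
  intro n hn
  rw [Nat.sum_divisorsAntidiagonal' (fun a b => (ArithmeticFunction.moebius a : SymFun) * p b), cyc,
    ← nsmul_eq_mul, ← Nat.cast_smul_eq_nsmul ℚ, smul_smul,
    mul_one_div_cancel (by exact_mod_cast hn.ne'), one_smul]
  refine Finset.sum_congr rfl fun d _ => ?_
  rw [smul_eq_C_mul]
  simp

/-- Möbius inversion of `cyclePower_eq_sum`. -/
theorem evalCycle_cyc (x : Multiset ℕ+) (i : ℕ+) : evalCycle x (cyc i) = x.count i := by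
  have hmoeb := (ArithmeticFunction.sum_eq_iff_sum_mul_moebius_eq
    (f := fun d => (d : ℚ) * (x.count d.toPNat' : ℚ)) (g := cyclePower x)).1
      (fun n hn => (cyclePower_eq_sum x hn).symm) i i.pos
  have hi : (i : ℚ) ≠ 0 := by exact_mod_cast i.ne_zero
  rw [Nat.sum_divisorsAntidiagonal'
    (fun a b => (ArithmeticFunction.moebius a : ℚ) * cyclePower x b)] at hmoeb
  rw [cyc, map_smul, map_sum]
  have hterm : ∀ d ∈ (i : ℕ).divisors,
      evalCycle x ((ArithmeticFunction.moebius (i / d) : ℚ) • p d) =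
        (ArithmeticFunction.moebius (i / d) : ℚ) * cyclePower x d := by
    intro d hd
    rw [map_smul, smul_eq_mul, evalCycle_p x (Nat.pos_of_mem_divisors hd)]
  rw [Finset.sum_congr rfl hterm, hmoeb, smul_eq_mul]
  simp only [PNat.coe_toPNat']
  field_simp

/-- A symmetric function is determined by its values at cycle types. -/
theorem ext_evalCycle {F G : SymFun} (hFG : ∀ x, evalCycle x F = evalCycle x G) : F = G := by
  classical
  -- ρ rewrites p_k as ∑_{d ∣ k} d X_d and κ substitutes `cyc` back, so ρ is injective; evaluation
  -- at x becomes evaluation of the rewritten polynomial at the multiplicities of x.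
  let ρ : SymFun →ₐ[ℚ] SymFun :=
    aeval fun k : ℕ+ => ∑ d ∈ (k : ℕ).divisors, (d : SymFun) * X d.toPNat'
  let κ : SymFun →ₐ[ℚ] SymFun := aeval fun i : ℕ+ => cyc i
  have hκρ : ∀ f, κ (ρ f) = f := by
    intro f
    have : κ.comp ρ = AlgHom.id ℚ SymFun := by
      ext1 k
      have hk := sum_divisors_cyc k.pos
      rw [AlgHom.comp_apply, aeval_X, map_sum, AlgHom.id_apply]
      refine Eq.trans (Finset.sum_congr rfl fun d hd => ?_) (hk.trans (by simp [p]))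
      rw [map_mul, map_natCast, aeval_X, Nat.toPNat'_coe, if_pos (Nat.pos_of_mem_divisors hd)]
    exact DFunLike.congr_fun this f
  have hev : ∀ x f, eval (fun i => (Multiset.count i x : ℚ)) (ρ f) = evalCycle x f := by
    intro x f
    have : (aeval fun i => (Multiset.count i x : ℚ)).comp ρ = evalCycle x := by
      ext1 k
      rw [AlgHom.comp_apply, aeval_X, map_sum, evalCycle, aeval_X, cyclePower_eq_sum x k.pos]
      refine Finset.sum_congr rfl fun d _ => ?_
      rw [map_mul, map_natCast, aeval_X]
    rw [← this, AlgHom.comp_apply, aeval_eq_eval]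
  have hρ : ρ F = ρ G := by
    refine funext_set (fun _ => Set.range ((↑) : ℕ → ℚ))
      (fun _ => Set.infinite_range_of_injective Nat.cast_injective) fun y hy => ?_
    choose m hm using fun i => hy i (Set.mem_univ i)
    -- Only finitely many variables occur, so a finite cycle type realises every relevant
    -- natural-number point.
    let x : Multiset ℕ+ := ∑ i ∈ (ρ F).vars ∪ (ρ G).vars, Multiset.replicate (m i) i
    have hx : ∀ i ∈ (ρ F).vars ∪ (ρ G).vars, (Multiset.count i x : ℚ) = y i := by
      intro i hi
      rw [← hm, Multiset.count_sum']
      simp only [Multiset.count_replicate]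
      rw [Finset.sum_ite_eq' _ i, if_pos hi]
    have hagree : ∀ f, f.vars ⊆ (ρ F).vars ∪ (ρ G).vars →
        eval y f = eval (fun i => (Multiset.count i x : ℚ)) f := by
      intro f hf
      refine hom_congr_vars (by ext; simp) (fun i hi _ => ?_) rfl
      rw [eval_X, eval_X, hx i (hf hi)]
    rw [hagree _ Finset.subset_union_left, hagree _ Finset.subset_union_right, hev, hev, hFG]
  rw [← hκρ F, hρ, hκρ]

/-! ### The linear map `p^a ↦ ∏ i^{a_i} (X_i)_{a_i}` -/

/-- `i^e (X_i)_e`, where `X_i` is the number of cycles of length `i`. -/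
noncomputable def fallTerm (i e : ℕ) : SymFun :=
  ((i : ℚ) ^ e) • (descPochhammer SymFun e).eval (cyc i)

theorem fallTerm_zero (i : ℕ) : fallTerm i 0 = 1 := by simp [fallTerm]

/-- The linear map `p^a ↦ ∏ i^{a_i} (X_i)_{a_i}`. -/
noncomputable def fallMap : SymFun →ₗ[ℚ] SymFun :=
  (basisMonomials ℕ+ ℚ).constr ℚ fun a => a.prod fun i e => fallTerm i e

theorem fallMap_monomial (a : ℕ+ →₀ ℕ) (r : ℚ) :
    fallMap (monomial a r) = r • a.prod fun i e => fallTerm i e := by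
  have h1 := (basisMonomials ℕ+ ℚ).constr_basis ℚ (fun a => a.prod fun i e => fallTerm i e) a
  rw [coe_basisMonomials] at h1
  rw [← mul_one r, ← smul_eq_mul, ← smul_monomial, map_smul, smul_eq_mul, mul_one]
  exact congrArg _ h1

/-- `∏ i^{a_i} (m_i)_{a_i}`, where `m_i` is the number of cycles of length `i` in `x`. -/
noncomputable def fallValue (x : Multiset ℕ+) (a : ℕ+ →₀ ℕ) : ℚ :=
  a.prod fun i e => (i : ℚ) ^ e * ((x.count i).descFactorial e : ℚ)

theorem evalCycle_fallMap_monomial (x : Multiset ℕ+) (a : ℕ+ →₀ ℕ) (r : ℚ) :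
    evalCycle x (fallMap (monomial a r)) = r * fallValue x a := by
  rw [fallMap_monomial, map_smul, smul_eq_mul, Finsupp.prod, map_prod]
  congr 1
  refine Finset.prod_congr rfl fun i _ => ?_
  have h1 := Polynomial.eval₂_at_apply (p := descPochhammer SymFun (a i))
    (evalCycle x : SymFun →+* ℚ) (cyc i)
  rw [← Polynomial.eval_map, descPochhammer_map] at h1
  simp only [RingHom.coe_coe] at h1
  rw [fallTerm, map_smul, ← h1, evalCycle_cyc, descPochhammer_eval_eq_descFactorial, smul_eq_mul]

/-- This is (m + 1)_e = (m)_e + e (m)_{e-1} in the factor for c. When a_c = 0 the truncated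
subtraction is harmless, as its coefficient vanishes. -/
theorem fallValue_cons (c : ℕ+) (x : Multiset ℕ+) (a : ℕ+ →₀ ℕ) :
    fallValue (c ::ₘ x) a =
      fallValue x a + c * a c * fallValue x (a - Finsupp.single c 1) := by
  have hsplit : ∀ (x : Multiset ℕ+) (a : ℕ+ →₀ ℕ), fallValue x a =
      ((c : ℚ) ^ (a c) * ((x.count c).descFactorial (a c) : ℚ)) * fallValue x (a.erase c) := by
    intro x a
    exact (Finsupp.mul_prod_erase' a c
      (fun i e => (i : ℚ) ^ e * ((x.count i).descFactorial e : ℚ)) (by simp)).symm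
  have herase : fallValue (c ::ₘ x) (a.erase c) = fallValue x (a.erase c) := by
    refine Finset.prod_congr rfl fun i hi => ?_
    rw [Finsupp.support_erase] at hi
    dsimp only
    rw [Multiset.count_cons_of_ne (Finset.ne_of_mem_erase hi)]
  have hsub : (a - Finsupp.single c 1).erase c = a.erase c := by
    ext i
    by_cases hi : i = c
    · subst hi; simp
    · rw [Finsupp.erase_ne hi, Finsupp.erase_ne hi, Finsupp.tsub_apply,
        Finsupp.single_eq_of_ne hi]
      simp
  rw [hsplit _ a, herase, hsplit x a, hsplit x (a - _), hsub, Finsupp.tsub_apply,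
    Finsupp.single_eq_same, Multiset.count_cons_self, ← mul_assoc, ← add_mul]
  congr 1
  generalize a c = e
  generalize Multiset.count c x = m
  rcases e with _ | k
  · simp
  · rw [Nat.succ_descFactorial_succ, Nat.descFactorial_succ, Nat.add_sub_cancel]
    rcases le_or_gt k m with hkm | hkm
    · push_cast [Nat.cast_sub hkm]
      ring
    · rw [Nat.descFactorial_of_lt hkm]
      simp

/-- On monomials, the second term of `fallValue_cons` is exactly c ∂/∂p_c. -/
theorem evalCycle_fallMap_cons (c : ℕ+) (x : Multiset ℕ+) (f : SymFun) :
    evalCycle (c ::ₘ x) (fallMap f) =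
      evalCycle x (fallMap f) + evalCycle x (fallMap (perp c f)) := by
  induction f using MvPolynomial.induction_on' with
  | monomial a r =>
    rw [perp, Derivation.smul_apply, pderiv_monomial, map_smul, map_smul,
      evalCycle_fallMap_monomial, evalCycle_fallMap_monomial, evalCycle_fallMap_monomial,
      fallValue_cons, smul_eq_mul]
    ring
  | add f g hf hg =>
    simp only [map_add, hf, hg]
    ring

theorem evalCycle_zero (f : SymFun) : evalCycle 0 f = constantCoeff f := by
  have : evalCycle 0 = aeval fun _ => (0 : ℚ) := by
    ext k; simp [evalCycle, cyclePower]
  rw [this, aeval_zero']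
  simp

theorem evalCycle_zero_fallMap (f : SymFun) : evalCycle 0 (fallMap f) = constantCoeff f := by
  induction f using MvPolynomial.induction_on' with
  | monomial a r =>
    rw [evalCycle_fallMap_monomial, constantCoeff_monomial]
    split_ifs with ha
    · subst ha; simp [fallValue]
    · obtain ⟨i, hi⟩ := Finsupp.support_nonempty_iff.2 ha
      rw [fallValue, Finsupp.prod, Finset.prod_eq_zero hi, mul_zero]
      rw [Multiset.count_zero, Nat.descFactorial_of_lt
        (Nat.pos_of_ne_zero (Finsupp.mem_support_iff.1 hi))]
      simp
  | add f g hf hg => simp only [map_add, hf, hg]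

/-! ### Products of `h` over the multiplicities of a multiset -/

section hMul

variable {α : Type*} [DecidableEq α]

/-- The product of the `h_m` over the multiplicities `m` of the distinct elements of `s`. -/
noncomputable def hMul (s : Multiset α) : SymFun := ∏ a ∈ s.toFinset, h (s.count a)

theorem hMul_eq_prod {s : Multiset α} {T : Finset α} (hT : s.toFinset ⊆ T) :
    hMul s = ∏ a ∈ T, h (s.count a) := by
  refine Finset.prod_subset hT fun a _ ha => ?_
  rw [Multiset.mem_toFinset] at ha
  rw [Multiset.count_eq_zero_of_notMem ha, h_zero]

theorem constantCoeff_hMul (s : Multiset α) :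
    constantCoeff (hMul s) = if s = 0 then (1 : ℚ) else 0 := by
  split_ifs with hs
  · subst hs; simp [hMul]
  · obtain ⟨a, ha⟩ := Multiset.exists_mem_of_ne_zero hs
    rw [hMul, map_prod]
    refine Finset.prod_eq_zero (Multiset.mem_toFinset.2 ha) ?_
    rw [← hInt_natCast, constantCoeff_hInt, if_neg]
    exact_mod_cast Multiset.count_ne_zero.2 ha

theorem perp_hMul (c : ℕ+) (s : Multiset α) :
    perp c (hMul s) = ∑ a ∈ s.toFinset.filter fun a => (c : ℕ) ≤ s.count a,
      hMul (s - Multiset.replicate c a) := by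
  have h1 : hMul s = ∏ a ∈ s.toFinset, hInt (s.count a) := by
    simp only [hInt_natCast]; rfl
  rw [h1, perp_prod_hInt, Finset.sum_filter]
  refine Finset.sum_congr rfl fun a ha => ?_
  split_ifs with hc
  · rw [hMul_eq_prod (Multiset.toFinset_subset.2 (Multiset.subset_of_le tsub_le_self))]
    refine Finset.prod_congr rfl fun b _ => ?_
    rw [Multiset.count_sub, Multiset.count_replicate, ← hInt_natCast]
    congr 1
    by_cases hab : a = b
    · subst hab
      rw [Finsupp.single_eq_same, if_pos rfl]
      omega
    · rw [Finsupp.single_eq_of_ne (Ne.symm hab), if_neg hab]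
      simp
  · refine Finset.prod_eq_zero ha (hInt_of_neg ?_)
    rw [Finsupp.single_eq_same]
    omega

end hMul

theorem hPart_multType (π : Multiset (Multiset ℕ)) : hPart (multType π) = hMul π := by
  rw [hPart, multType, Multiset.map_map]
  rfl

theorem hPart_eq_hMul {n : ℕ} (lam : n.Partition) : hPart lam = hMul (content lam) := by
  have : hMul (content lam) = ((content lam).dedup.map fun a => h ((content lam).count a)).prod :=
    rfl
  rw [this, dedup_content, Multiset.map_map, hPart]
  conv_lhs => rw [← map_row lam, Multiset.map_map]
  congr 1
  refine Multiset.map_congr rfl fun i hi => ?_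
  simp only [Function.comp, count_content lam (Multiset.mem_range.1 hi)]

/-! ### The recursions in the cycle type -/

/-- A new cycle of length c multiplies the series of the h_n by 1 / (1 - t^c). -/
theorem evalCycle_cons_h (c : ℕ+) (x : Multiset ℕ+) (n : ℕ) :
    evalCycle (c ::ₘ x) (h n) =
      ∑ b ∈ Finset.range (n / c + 1), evalCycle x (h (n - c * b)) := by
  have hshift := map_h_of_shift (φ := (evalCycle (c ::ₘ x) : SymFun →+* ℚ))
    (ψ := (evalCycle x : SymFun →+* ℚ)) c c.pos 1 (fun k hk => by
      rw [RingHom.coe_coe, RingHom.coe_coe, evalCycle_p _ hk, evalCycle_p _ hk, cyclePower_cons]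
      simp)
  simp only [RingHom.coe_coe, one_mul] at hshift
  induction n using Nat.strong_induction_on with
  | _ n ih =>
    have h1 := hshift n
    have hc := c.pos
    rcases lt_or_ge n c with hlt | hge
    · rw [if_neg (by omega), sub_zero] at h1
      rw [← h1, Nat.div_eq_of_lt hlt]
      simp
    · rw [if_pos hge, ih (n - c) (by omega)] at h1
      rw [Finset.sum_range_succ', mul_zero, Nat.sub_zero, h1, Nat.div_eq_sub_div hc hge]
      have : ∀ b, n - c - c * b = n - c * (b + 1) := by
        intro b; rw [mul_add, mul_one]; omega
      simp only [this]
      ring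

/-- Distributivity, with a choice of one index per element of A read as the multiset having these
multiplicities. -/
theorem prod_sum_range_eq_sum_multiset (A : Finset ℕ) (t : ℕ → ℕ) (F : ℕ → ℕ → ℚ)
    (U : Finset (Multiset ℕ))
    (hU : ∀ S, S ∈ U ↔ (∀ a ∈ A, S.count a ≤ t a) ∧ ∀ a ∉ A, S.count a = 0) :
    ∏ a ∈ A, ∑ b ∈ Finset.range (t a + 1), F a b = ∑ S ∈ U, ∏ a ∈ A, F a (S.count a) := by
  rw [Finset.prod_sum]
  have hcount : ∀ (q : ∀ a ∈ A, ℕ) (a : ℕ),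
      (∑ y ∈ A.attach, Multiset.replicate (q y.1 y.2) y.1).count a =
        if ha : a ∈ A then q a ha else 0 := by
    intro q a
    rw [Multiset.count_sum']
    simp only [Multiset.count_replicate]
    split_ifs with ha
    · rw [Finset.sum_eq_single ⟨a, ha⟩]
      · simp
      · rintro ⟨b, hb⟩ _ hne
        exact if_neg fun heq => hne (Subtype.ext heq)
      · simp
    · refine Finset.sum_eq_zero fun y _ => if_neg ?_
      rintro rfl
      exact ha y.2
  refine Finset.sum_bij' (fun q _ => ∑ y ∈ A.attach, Multiset.replicate (q y.1 y.2) y.1)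
    (fun S _ a _ => S.count a) ?_ ?_ ?_ ?_ ?_
  · intro q hq
    rw [Finset.mem_pi] at hq
    rw [hU]
    refine ⟨fun a ha => ?_, fun a ha => ?_⟩
    · rw [hcount, dif_pos ha]
      exact Nat.lt_succ_iff.1 (Finset.mem_range.1 (hq a ha))
    · rw [hcount, dif_neg ha]
  · intro S hS
    rw [Finset.mem_pi]
    exact fun a ha => Finset.mem_range.2 (Nat.lt_succ_of_le (((hU S).1 hS).1 a ha))
  · intro q _
    funext a ha
    rw [hcount, dif_pos ha]
  · intro S hS
    ext a
    refine (hcount (fun a _ => S.count a) a).trans ?_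
    split_ifs with ha
    · rfl
    · exact (((hU S).1 hS).2 a ha).symm
  · intro q _
    rw [← Finset.prod_attach A]
    refine Finset.prod_congr rfl fun y _ => ?_
    rw [hcount, dif_pos y.2]

/-- The multisets `S` with `c • S ≤ M`. -/
def divisorMultisets (c : ℕ) (M : Multiset ℕ) : Finset (Multiset ℕ) :=
  M.powerset.toFinset.filter fun S => c • S ≤ M

theorem mem_divisorMultisets {c : ℕ} (hc : 0 < c) {M S : Multiset ℕ} :
    S ∈ divisorMultisets c M ↔ c • S ≤ M := by
  rw [divisorMultisets, Finset.mem_filter, Multiset.mem_toFinset, Multiset.mem_powerset,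
    and_iff_right_iff_imp]
  intro hS
  refine le_trans (Multiset.le_iff_count.2 fun a => ?_) hS
  rw [Multiset.count_nsmul]
  exact Nat.le_mul_of_pos_left _ hc

theorem evalCycle_cons_hMul (c : ℕ+) (x : Multiset ℕ+) (M : Multiset ℕ) :
    evalCycle (c ::ₘ x) (hMul M) =
      ∑ S ∈ divisorMultisets c M, evalCycle x (hMul (M - (c : ℕ) • S)) := by
  rw [hMul, map_prod]
  simp only [evalCycle_cons_h]
  rw [prod_sum_range_eq_sum_multiset M.toFinset (fun a => M.count a / c)
    (fun a b => evalCycle x (h (M.count a - c * b))) (divisorMultisets c M)]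
  · refine Finset.sum_congr rfl fun S _ => ?_
    rw [hMul_eq_prod (Multiset.toFinset_subset.2 (Multiset.subset_of_le tsub_le_self)), map_prod]
    refine Finset.prod_congr rfl fun a _ => ?_
    rw [Multiset.count_sub, Multiset.count_nsmul]
  · intro S
    rw [mem_divisorMultisets c.pos, Multiset.le_iff_count]
    simp only [Multiset.count_nsmul, Multiset.mem_toFinset, Nat.le_div_iff_mul_le c.pos]
    refine ⟨fun hS => ⟨fun a _ => by rw [mul_comm]; exact hS a, fun a ha => ?_⟩,
      fun hS a => ?_⟩
    · have := hS a
      rw [Multiset.count_eq_zero_of_notMem ha, Nat.le_zero, mul_eq_zero] at this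
      exact this.resolve_left c.ne_zero
    · by_cases ha : a ∈ M
      · rw [mul_comm]; exact hS.1 a ha
      · rw [hS.2 a ha, mul_zero]; exact Nat.zero_le _

/-- Removing c copies of a block S from π is undone by adding them back. S = 0 is excluded because
blocks are nonempty. -/
theorem sum_perp_multisetPartitions {E : Type*} [AddCommMonoid E] (c : ℕ+) (M : Multiset ℕ)
    (g : Multiset (Multiset ℕ) → E) :
    ∑ π ∈ multisetPartitions M, ∑ S ∈ π.toFinset.filter fun S => (c : ℕ) ≤ π.count S,
        g (π - Multiset.replicate c S) =
      ∑ S ∈ (divisorMultisets c M).erase 0, ∑ π ∈ multisetPartitions (M - (c : ℕ) • S), g π := by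
  rw [Finset.sum_sigma', Finset.sum_sigma']
  refine Finset.sum_bij' (fun y _ => ⟨y.2, y.1 - Multiset.replicate c y.2⟩)
    (fun y _ => ⟨y.2 + Multiset.replicate c y.1, y.1⟩) ?_ ?_ ?_ ?_ ?_
  · rintro ⟨π, S⟩ hy
    simp only [Finset.mem_sigma, Finset.mem_filter, Multiset.mem_toFinset,
      mem_multisetPartitions, Finset.mem_erase, mem_divisorMultisets c.pos] at hy ⊢
    obtain ⟨⟨hsum, h0⟩, hS, hc⟩ := hy
    have hle : Multiset.replicate c S ≤ π := Multiset.le_count_iff_replicate_le.1 hc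
    have hsum' : (π - Multiset.replicate c S).sum + (c : ℕ) • S = M := by
      rw [← hsum]
      conv_rhs => rw [← tsub_add_cancel_of_le hle]
      rw [Multiset.sum_add, Multiset.sum_replicate]
    refine ⟨⟨fun hh => h0 (hh ▸ hS), ?_⟩, ?_, fun hh => h0 (Multiset.mem_of_le tsub_le_self hh)⟩
    · rw [← hsum']; exact le_add_self
    · exact eq_tsub_of_add_eq hsum'
  · rintro ⟨S, π⟩ hy
    simp only [Finset.mem_sigma, Finset.mem_filter, Multiset.mem_toFinset,
      mem_multisetPartitions, Finset.mem_erase, mem_divisorMultisets c.pos] at hy ⊢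
    obtain ⟨⟨hS0, hle⟩, hsum, h0⟩ := hy
    refine ⟨⟨?_, ?_⟩, ?_, ?_⟩
    · rw [Multiset.sum_add, Multiset.sum_replicate, hsum, tsub_add_cancel_of_le hle]
    · rw [Multiset.mem_add]
      rintro (hh | hh)
      · exact h0 hh
      · exact hS0 (Multiset.eq_of_mem_replicate hh).symm
    · exact Multiset.mem_add.2 (Or.inr (Multiset.mem_replicate.2 ⟨c.ne_zero, rfl⟩))
    · rw [Multiset.count_add, Multiset.count_replicate_self]
      exact Nat.le_add_left _ _
  · rintro ⟨π, S⟩ hy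
    simp only [Finset.mem_sigma, Finset.mem_filter] at hy
    have hle : Multiset.replicate c S ≤ π := Multiset.le_count_iff_replicate_le.1 hy.2.2
    simp only [tsub_add_cancel_of_le hle]
  · rintro ⟨S, π⟩ _
    simp only [add_tsub_cancel_right]
  · rintro ⟨π, S⟩ _
    rfl

/-- The value of `h_λ` at a cycle type, as a sum over multiset partitions. -/
theorem evalCycle_hMul (x : Multiset ℕ+) (M : Multiset ℕ) :
    evalCycle x (hMul M) = ∑ π ∈ multisetPartitions M, evalCycle x (fallMap (hMul π)) := by
  induction x using Multiset.induction generalizing M with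
  | empty =>
    simp only [evalCycle_zero_fallMap, constantCoeff_hMul]
    rw [evalCycle_zero, constantCoeff_hMul, Finset.sum_ite_eq']
    simp [mem_multisetPartitions, eq_comm]
  | cons c x ih =>
    rw [evalCycle_cons_hMul]
    simp only [evalCycle_fallMap_cons, perp_hMul, map_sum]
    rw [Finset.sum_add_distrib,
      sum_perp_multisetPartitions c M fun π => evalCycle x (fallMap (hMul π)), ← ih]
    simp only [← ih]
    -- The term S = 0 is the value before the cycle was added; the others match the derivative
    -- terms.
    rw [← Finset.add_sum_erase _ _ (show (0 : Multiset ℕ) ∈ divisorMultisets c M by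
      rw [mem_divisorMultisets c.pos]; simp)]
    simp

/-- The induced trivial character basis is the image of the `h_λ` under `fallMap`. -/
theorem hTilde_eq_fallMap {n : ℕ} (lam : n.Partition) : hTilde lam = fallMap (hPart lam) := by
  induction n using Nat.strong_induction_on with
  | _ n ih =>
    have h1 : hPart lam = ∑ π ∈ multisetPartitions (content lam), fallMap (hPart (multType π)) := by
      simp only [hPart_multType]
      rw [hPart_eq_hMul]
      refine ext_evalCycle fun x => ?_
      rw [evalCycle_hMul, map_sum]
    have h2 := hPart_eq_sum_hTilde lam
    -- Both families satisfy the same relation. Every π other than the all-singletons one has fewer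
    -- than n blocks, so its difference vanishes by induction, leaving the term of type λ.
    rw [h1, eq_comm, ← sub_eq_zero, ← Finset.sum_sub_distrib,
      Finset.sum_eq_single ((content lam).map fun a => {a})] at h2
    · have hcongr : ∀ {a b : ℕ} (_ : a = b) (α : a.Partition) (β : b.Partition),
          α.parts = β.parts → hTilde α - fallMap (hPart α) = 0 →
            hTilde β = fallMap (hPart β) := by
        rintro a _ rfl α β hp hα
        rw [← Nat.Partition.ext hp]
        exact sub_eq_zero.1 hα
      exact hcongr (by rw [Multiset.card_map, card_content]) _ lam (multType_singletons lam) h2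
    · intro π hπ hne
      obtain ⟨hsum, h0⟩ := mem_multisetPartitions.1 hπ
      rw [ih π.card ?_ (multType π), sub_self]
      by_contra hlt
      exact hne (eq_singletons hsum h0 (by rw [card_content]; omega))
    · intro hnot
      refine absurd (mem_multisetPartitions.2 ⟨Multiset.sum_map_singleton _, ?_⟩) hnot
      intro hh
      obtain ⟨a, -, ha⟩ := Multiset.mem_map.1 hh
      exact Multiset.singleton_ne_zero a ha

/-! ### The power sum expansion -/

/-- Falling factorials are not multiplicative in the exponent, so `fallMap` respects products only
when no variable is shared. -/
theorem fallMap_mul_of_disjoint {f g : SymFun} (hfg : Disjoint f.vars g.vars) :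
    fallMap (f * g) = fallMap f * fallMap g := by
  have hsum : ∀ f : SymFun, fallMap f =
      ∑ a ∈ f.support, f.coeff a • a.prod fun i e => fallTerm i e := by
    intro f
    conv_lhs => rw [f.as_sum]
    rw [map_sum]
    simp only [fallMap_monomial]
  conv_lhs => rw [f.as_sum, g.as_sum]
  rw [Finset.sum_mul_sum, map_sum, hsum f, hsum g, Finset.sum_mul_sum]
  refine Finset.sum_congr rfl fun a ha => ?_
  rw [map_sum]
  refine Finset.sum_congr rfl fun b hb => ?_
  have hab : Disjoint a.support b.support := by
    rw [Finset.disjoint_left] at hfg ⊢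
    exact fun i hi hi' => hfg (mem_vars_iff_mem_support i |>.2 ⟨a, ha, hi⟩)
      (mem_vars_iff_mem_support i |>.2 ⟨b, hb, hi'⟩)
  rw [monomial_mul, fallMap_monomial, Finsupp.prod_add_index_of_disjoint hab, smul_mul_smul_comm]

theorem fallMap_prod (A : Finset ℕ+) (g : ℕ+ → SymFun) (hg : ∀ i, (g i).vars ⊆ {i}) :
    fallMap (∏ i ∈ A, g i) = ∏ i ∈ A, fallMap (g i) := by
  classical
  induction A using Finset.induction_on with
  | empty =>
    rw [Finset.prod_empty, Finset.prod_empty, show (1 : SymFun) = monomial 0 1 from rfl,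
      fallMap_monomial]
    simp
  | insert i A hi ih =>
    rw [Finset.prod_insert hi, Finset.prod_insert hi, fallMap_mul_of_disjoint, ih]
    rw [Finset.disjoint_left]
    intro j hj hj'
    obtain ⟨k, hk, hk'⟩ := Finset.mem_biUnion.1 (vars_prod g hj')
    have h1 := Finset.mem_singleton.1 (hg i hj)
    have h2 := Finset.mem_singleton.1 (hg k hk')
    exact hi (by rwa [← h1, h2])

theorem fallMap_X_sub_one_pow (i : ℕ+) (r : ℕ) : fallMap ((X i - 1) ^ r) = boldP i r := by
  rw [sub_eq_add_neg, add_pow, map_sum, boldP]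
  refine Finset.sum_congr rfl fun k _ => ?_
  have h1 : (X i : SymFun) ^ k * (-1) ^ (r - k) * (r.choose k : SymFun) =
      monomial (Finsupp.single i k) ((-1) ^ (r - k) * (r.choose k : ℚ)) := by
    rw [← mul_one ((-1) ^ (r - k) * (r.choose k : ℚ)), ← C_mul_monomial, ← X_pow_eq_monomial]
    simp only [map_mul, map_pow, map_neg, map_one, map_natCast]
    ring
  rw [h1, fallMap_monomial,
    Finsupp.prod_single_index (h := fun (i : ℕ+) e => fallTerm i e) (fallTerm_zero i), fallTerm,
    smul_smul]
  congr 1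
  ring

theorem fallMap_shift_pPart {n : ℕ} (γ : n.Partition) :
    fallMap (shift (pPart γ)) = boldPPart γ := by
  have hzero : ∀ i, boldP i 0 = 1 := fun i => by simp [boldP]
  rw [pPart_eq_monomial, monomial_eq, C_1, one_mul, Finsupp.prod, map_prod, boldPPart,
    prod_count_eq γ boldP hzero, Finsupp.prod]
  simp only [map_pow, shift, aeval_X]
  rw [fallMap_prod _ (fun i => (X i - 1) ^ mon γ i)]
  · exact Finset.prod_congr rfl fun i _ => fallMap_X_sub_one_pow i _
  · classical
    intro i
    refine (vars_pow _ _).trans ((vars_sub_subset _).trans ?_)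
    simp [vars_X]

/-! ### Homogeneity and the power sum expansion of Schur functions. -/

theorem isWeightedHomogeneous_h (n : ℕ) :
    IsWeightedHomogeneous (fun k : ℕ+ => (k : ℕ)) (h n) n := by
  intro a ha
  rw [coeff_h] at ha
  by_contra hne
  exact ha (if_neg hne)

theorem isWeightedHomogeneous_hPart {n : ℕ} (μ : n.Partition) :
    IsWeightedHomogeneous (fun k : ℕ+ => (k : ℕ)) (hPart μ) n := by
  have key : ∀ s : Multiset ℕ,
      IsWeightedHomogeneous (fun k : ℕ+ => (k : ℕ)) (s.map h).prod s.sum := by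
    intro s
    induction s using Multiset.induction with
    | empty => simpa using isWeightedHomogeneous_one ℚ _
    | cons a s ih =>
      rw [Multiset.map_cons, Multiset.prod_cons, Multiset.sum_cons]
      exact (isWeightedHomogeneous_h a).mul ih
  have := key μ.parts
  rwa [μ.parts_sum] at this

/-- By homogeneity only the p_γ with γ ⊢ n occur, and pairing with p_γ reads off the coefficient
times z_γ ≠ 0. -/
theorem schur_eq_sum {n : ℕ} (lam : n.Partition) :
    schur lam = ∑ γ : n.Partition, (chi lam γ / z γ) • pPart γ := by
  have hhom : schur lam ∈ weightedHomogeneousSubmodule ℚ (fun k : ℕ+ => (k : ℕ)) n := by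
    refine Submodule.span_le.2 ?_ (schur_mem_span lam)
    rintro _ ⟨μ, rfl⟩
    exact isWeightedHomogeneous_hPart μ
  have hchi : ∀ γ : n.Partition, chi lam γ / z γ = (schur lam).coeff (mon γ) := by
    intro γ
    rw [chi, hall_pPart, mul_div_cancel_right₀]
    rw [z_eq_zf]
    exact zf_ne_zero _
  ext a
  simp only [hchi, pPart_eq_monomial, coeff_sum, coeff_smul, coeff_monomial, smul_eq_mul,
    mul_ite, mul_one, mul_zero]
  by_cases ha : wt a = n
  · obtain ⟨γ, rfl⟩ := exists_mon_eq ha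
    simp only [mon_injective.eq_iff]
    simp
  · rw [Finset.sum_eq_zero]
    · by_contra hne
      exact ha (hhom hne)
    · intro γ _
      exact if_neg fun heq => ha (by rw [← heq, wt_mon])

end CharBasis

theorem mainTheorem7 {n : ℕ} (lam : n.Partition) (N : ℕ) (hN : 2 * n ≤ N) :
    CharBasis.sTilde N lam hN =
      ∑ γ : n.Partition, (CharBasis.chi lam γ / CharBasis.z γ) • CharBasis.boldPPart γ := by
  rw [CharBasis.sTilde_eq_of_hTilde_eq CharBasis.hTilde_eq_fallMap lam hN]
  conv_lhs => rw [CharBasis.schur_eq_sum lam, map_sum, map_sum]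
  simp only [map_smul, CharBasis.fallMap_shift_pPart]
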